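/- Let $n\ge 1$ and let $D\subseteq\mathbb{C}^n$ be a reduced divisor, given by a global holomorphic equation $f$ which generates its ideal sheaf. A holomorphic vector field $\delta$ is logarithmic along $D$, $\delta\in\operatorname{Der}(-\log D)$, if $\delta(f)\in\mathcal{O}\cdot f$. Suppose that $D$ is a linear free divisor: the sheaf $\operatorname{Der}(-\log D)$ is locally free, and the $\Gamma(\mathbb{C}^n,\mathcal{O})$-module $\Gamma(\mathbb{C}^n,\operatorname{Der}(-\log D))$ has a basis $\delta_1,\dots,\delta_n$ of vector fields of degree $0$, that is, of the form $\sum_{i,j}x_ia_{ij}\partial_j$ with $a_{ij}\in\mathbb{C}$. Fix such a basis, called a global degree-$0$ basis, and put $\Delta=\det(\delta_i(x_j))_{i,j}$. Identify $\sum_{i,j}x_ia_{ij}\partial_j$ with the matrix $(a_{ij})$, so that the Lie bracket becomes the commutator; for a matrix $\delta$ let $\delta_S$ be the semisimple part of its Jordan decomposition. Let $\chi=\sum_i x_i\partial_i$, and let $s+1$ be the maximal number of linearly independent logarithmic vector fields which are diagonal in a common system of linear coordinates. Then there is a global degree-$0$ basis $\chi,\sigma_1,\dots,\sigma_s,\nu_1,\dots,\nu_{n-s-1}$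 of $\operatorname{Der}(-\log D)$ such that: 1. $[\chi,\sigma_i]=0$ and $[\chi,\nu_j]=0$ for all $i,j$; 2. the $\sigma_i$ are simultaneously diagonalizable with eigenvalues in $\mathbb{Q}$, and $\sigma_i(\Delta)=0$; 3. the $\nu_j$ are nilpotent, and $\nu_j(\Delta)=0$; 4. there are $q_{ij}\in\mathbb{Q}$ with $[\sigma_i,\nu_j]=q_{ij}\nu_j$ for all $i,j$, and $\sum_j q_{ij}+\operatorname{tr}(\sigma_i)=0$ for every $i$; 5. if $\delta$ is a logarithmic vector field of degree $0$ with $[\sigma_i,\delta]=0$ for $i=1,\dots,s$, then $\delta_S\in\langle\chi,\sigma_1,\dots,\sigma_s\rangle_{\mathbb{C}}$; if moreover $\delta(\Delta)=0$, then $\delta_S\in\langle\sigma_1,\dots,\sigma_s\rangle_{\mathbb{C}}$. Moreover, $s\ge 1$ if $n\ge 2$; and if $s=n-1$, then there are linear coordinates $y_1,\dots,y_n$ on $\mathbb{C}^n$ with $\Delta=y_1\cdots y_n$ and $D=\{y_1\cdots y_n=0\}$, so $D$ is a normal crossing divisor. -/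

import Mathlib

namespace LFD

/-- A divisor `D ⊆ ℂⁿ` is given by a global holomorphic equation `f`, not identically zero, with
`D = {f = 0}`. It is reduced when `f` generates the ideal sheaf of its zero set: every holomorphic
function on an open set `U` that vanishes on `D ∩ U` is a multiple of `f` on `U`. -/
structure IsReducedEquation {n : ℕ} (f : (Fin n → ℂ) → ℂ) : Prop where
  holomorphic : AnalyticOnNhd ℂ f Set.univ
  ne_zero : ∃ x, f x ≠ 0
  reduced : ∀ (U : Set (Fin n → ℂ)) (g : (Fin n → ℂ) → ℂ), IsOpen U → AnalyticOnNhd ℂ g U →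
    (∀ x ∈ U, f x = 0 → g x = 0) →
      ∃ q : (Fin n → ℂ) → ℂ, AnalyticOnNhd ℂ q U ∧ ∀ x ∈ U, g x = q x * f x

/-- The action `v(g) = ∑ⱼ vⱼ ∂ⱼ g` of a vector field `v = ∑ⱼ vⱼ ∂ⱼ` on a function `g`. -/
noncomputable def act {n : ℕ} (v : (Fin n → ℂ) → (Fin n → ℂ)) (g : (Fin n → ℂ) → ℂ) :
    (Fin n → ℂ) → ℂ :=
  fun x => fderiv ℂ g x (v x)

/-- `v` is a section over `U` of `Der(-log D)`, where `D = {f = 0}`: it is holomorphic on `U` and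
`v(f) ∈ 𝒪(U) · f`. -/
def IsLogarithmic {n : ℕ} (f : (Fin n → ℂ) → ℂ) (U : Set (Fin n → ℂ))
    (v : (Fin n → ℂ) → (Fin n → ℂ)) : Prop :=
  AnalyticOnNhd ℂ v U ∧
    ∃ g : (Fin n → ℂ) → ℂ, AnalyticOnNhd ℂ g U ∧ ∀ x ∈ U, act v f x = g x * f x

/-- The family `η` is a basis of the `𝒪(U)`-module `Γ(U, Der(-log D))`, where `D = {f = 0}`: its
members are sections, and each section is a combination of them with holomorphic coefficients,
which are unique as functions on `U`. -/
def IsLogBasis {n : ℕ} {ι : Type} [Fintype ι] (f : (Fin n → ℂ) → ℂ) (U : Set (Fin n → ℂ))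
    (η : ι → (Fin n → ℂ) → (Fin n → ℂ)) : Prop :=
  (∀ i, IsLogarithmic f U (η i)) ∧
  (∀ v, IsLogarithmic f U v → ∃ h : ι → (Fin n → ℂ) → ℂ,
    (∀ i, AnalyticOnNhd ℂ (h i) U) ∧ ∀ x ∈ U, v x = ∑ i, h i x • η i x) ∧
  (∀ h h' : ι → (Fin n → ℂ) → ℂ,
    (∀ i, AnalyticOnNhd ℂ (h i) U) → (∀ i, AnalyticOnNhd ℂ (h' i) U) →
    (∀ x ∈ U, ∑ i, h i x • η i x = ∑ i, h' i x • η i x) →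
      ∀ i, ∀ x ∈ U, h i x = h' i x)

/-- The divisor `D = {f = 0}` is free: the sheaf `Der(-log D)` is locally free (of finite rank). -/
def IsFree {n : ℕ} (f : (Fin n → ℂ) → ℂ) : Prop :=
  ∀ p : Fin n → ℂ, ∃ U : Set (Fin n → ℂ), IsOpen U ∧ p ∈ U ∧
    ∃ (r : ℕ) (η : Fin r → (Fin n → ℂ) → (Fin n → ℂ)),
      ∀ V : Set (Fin n → ℂ), IsOpen V → V ⊆ U → IsLogBasis f V η

/-- The vector field of degree `0` with matrix `A`, namely `∑ᵢⱼ xᵢ aᵢⱼ ∂ⱼ`. -/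
def lin {n : ℕ} (A : Matrix (Fin n) (Fin n) ℂ) : (Fin n → ℂ) → (Fin n → ℂ) :=
  fun x => Matrix.vecMul x A

/-- The Lie bracket of vector fields of degree `0` corresponds to the commutator of matrices. -/
theorem lieBracket_lin {n : ℕ} (A B : Matrix (Fin n) (Fin n) ℂ) :
    VectorField.lieBracket ℂ (lin A) (lin B) = lin ⁅A, B⁆ := by
  have key : ∀ (C : Matrix (Fin n) (Fin n) ℂ) (x y : Fin n → ℂ),
      fderiv ℂ (lin C) x y = Matrix.vecMul y C := by
    intro C x y
    have h : lin C = ⇑(LinearMap.toContinuousLinearMap (Matrix.vecMulLinear C)) := rfl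
    rw [h, ContinuousLinearMap.fderiv]
    rfl
  funext x
  simp only [VectorField.lieBracket, key, lin, Ring.lie_def, Matrix.vecMul_sub,
    Matrix.vecMul_vecMul]

/-- The reduced divisor `{f = 0}` is a linear free divisor: it is free, and the module of its
global logarithmic vector fields has a basis `δ₁, …, δₙ` of vector fields of degree `0`. -/
def IsLinearFree {n : ℕ} (f : (Fin n → ℂ) → ℂ) : Prop :=
  IsReducedEquation f ∧ IsFree f ∧
    ∃ δ : Fin n → Matrix (Fin n) (Fin n) ℂ, IsLogBasis f Set.univ (fun i => lin (δ i))

/-- The function `Δ = det (δᵢ(xⱼ))` of vector fields `δ₁, …, δₙ` of degree `0`. -/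
noncomputable def discr {n : ℕ} (δ : Fin n → Matrix (Fin n) (Fin n) ℂ) : (Fin n → ℂ) → ℂ :=
  fun x => (Matrix.of fun i j => lin (δ i) x j).det

/-- The numbers `r` such that, in some linear coordinates, there are `r` linearly independent
diagonal vector fields that are logarithmic along `D = {f = 0}`. -/
def diagonalRanks {n : ℕ} (f : (Fin n → ℂ) → ℂ) : Set ℕ :=
  {r | ∃ P : Matrix (Fin n) (Fin n) ℂ, IsUnit P.det ∧ ∃ d : Fin r → Fin n → ℂ,
    LinearIndependent ℂ d ∧
      ∀ k, IsLogarithmic f Set.univ (lin (P * Matrix.diagonal (d k) * P⁻¹))}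

/-- `A = S + N` is the decomposition of `A` into its semisimple part `S` and its nilpotent
part `N`. -/
structure IsJordanDecomposition {n : ℕ} (A S N : Matrix (Fin n) (Fin n) ℂ) : Prop where
  eq_add : A = S + N
  commute : Commute S N
  semisimple : Module.End.IsSemisimple (Matrix.toLin' S)
  nilpotent : IsNilpotent N

end LFD

namespace LFD

open MvPolynomial Matrix Filter Topology

variable {n : ℕ}

/-! The logarithmic fields of degree 0 form a Lie algebra L of matrices, and everything rests on
describing L through Δ alone: A lies in L exactly when Δ is an eigenvector of A
(`mem_tangentMatrices_iff`). One direction differentiates the determinant, using that L is closed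
under brackets. The other needs only that f and Δ have the same zeros (`eq_zero_iff_discr_eq_zero`),
because the flow of A then preserves the zero set of f.

The eigenvector condition passes to Jordan parts (`IsJordanDecomposition.linDer_eq`), so L contains
the semisimple and nilpotent parts of its elements, and its nilpotent elements kill Δ. In
coordinates diagonalizing a maximal torus, the condition says that all monomials of Δ have the same
weight. Weight zero is a linear system with integer coefficients, so the torus is the sum of ℂχ and
a space with a rational basis killing Δ (`exists_rational_torus`).

Under the adjoint action of the torus, L is spanned by joint eigenvectors
(`tangentMatrices_le_span`). One of non-zero weight is nilpotent, since its powers would otherwise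
have infinitely many weights. One of zero weight has its semisimple part in the torus by maximality,
which leaves a nilpotent part. Extending the torus by such nilpotents gives the basis, and the trace
identity is again the derivative of the determinant.

If s = 0, every matrix killing Δ is nilpotent, and Engel's theorem gives independent linear forms
ℓ₁, ℓ₂ such that each of these matrices kills ℓ₁ and sends ℓ₂ into ℂℓ₁. Then f = kℓ₁ with k
vanishing on ℓ₁ = 0, a repeated factor that reducedness forbids (`not_isLogBasis_of_triangular`). If
s = n - 1, all of L is diagonal and Δ is a product of coordinates up to a constant. -/

/-! ### Linear vector fields as derivations of polynomials. -/

/-- The derivation `∑ᵢⱼ xᵢ aᵢⱼ ∂ⱼ` of the polynomial ring. -/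
noncomputable def linDer (A : Matrix (Fin n) (Fin n) ℂ) :
    Derivation ℂ (MvPolynomial (Fin n) ℂ) (MvPolynomial (Fin n) ℂ) :=
  mkDerivation ℂ fun j => ∑ i, A i j • X i

@[simp] theorem linDer_X (A : Matrix (Fin n) (Fin n) ℂ) (j : Fin n) :
    linDer A (X j) = ∑ i, A i j • X i := mkDerivation_X _ _ _

theorem linDer_add (A B : Matrix (Fin n) (Fin n) ℂ) : linDer (A + B) = linDer A + linDer B :=
  derivation_ext fun j => by simp [add_smul, Finset.sum_add_distrib]

theorem linDer_smul (c : ℂ) (A : Matrix (Fin n) (Fin n) ℂ) : linDer (c • A) = c • linDer A :=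
  derivation_ext fun j => by simp [mul_smul, Finset.smul_sum]

theorem linDer_zero : linDer (0 : Matrix (Fin n) (Fin n) ℂ) = 0 :=
  derivation_ext fun j => by simp

theorem linDer_linDer_X (A B : Matrix (Fin n) (Fin n) ℂ) (j : Fin n) :
    linDer A (linDer B (X j)) = ∑ i, (A * B) i j • X i := by
  simp only [linDer_X, map_sum, Derivation.map_smul, Finset.smul_sum, smul_smul,
    Matrix.mul_apply, Finset.sum_smul]
  rw [Finset.sum_comm]
  simp only [mul_comm]

theorem linDer_lie (A B : Matrix (Fin n) (Fin n) ℂ) :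
    linDer ⁅A, B⁆ = ⁅linDer A, linDer B⁆ :=
  derivation_ext fun j => by
    rw [Derivation.commutator_apply, linDer_linDer_X, linDer_linDer_X, linDer_X, Ring.lie_def,
      ← Finset.sum_sub_distrib]
    simp [sub_smul]

/-- The substitution `xₖ ↦ ∑ᵢ xᵢ pᵢₖ`. -/
noncomputable def subst (P : Matrix (Fin n) (Fin n) ℂ) :
    MvPolynomial (Fin n) ℂ →ₐ[ℂ] MvPolynomial (Fin n) ℂ :=
  aeval fun k => ∑ i, P i k • X i

@[simp] theorem subst_X (P : Matrix (Fin n) (Fin n) ℂ) (k : Fin n) :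
    subst P (X k) = ∑ i, P i k • X i := aeval_X _ _

theorem subst_subst (P Q : Matrix (Fin n) (Fin n) ℂ) (p : MvPolynomial (Fin n) ℂ) :
    subst P (subst Q p) = subst (P * Q) p := by
  have : (subst P).comp (subst Q) = subst (P * Q) := by
    refine algHom_ext fun j => ?_
    simp only [AlgHom.comp_apply, subst_X, map_sum, map_smul, Finset.smul_sum, smul_smul,
      Matrix.mul_apply, Finset.sum_smul]
    rw [Finset.sum_comm]
    simp only [mul_comm]
  exact DFunLike.congr_fun this p

theorem subst_one (p : MvPolynomial (Fin n) ℂ) : subst 1 p = p := by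
  have : subst (1 : Matrix (Fin n) (Fin n) ℂ) = AlgHom.id ℂ _ := by
    refine algHom_ext fun j => ?_
    simp [Matrix.one_apply]
  exact DFunLike.congr_fun this p

theorem linDer_subst {A B P : Matrix (Fin n) (Fin n) ℂ} (h : A * P = P * B)
    (p : MvPolynomial (Fin n) ℂ) : linDer A (subst P p) = subst P (linDer B p) := by
  induction p using MvPolynomial.induction_on with
  | C a => simp [← algebraMap_eq]
  | add p q hp hq => simp [hp, hq]
  | mul_X p j hp =>
    have key : linDer A (subst P (X j)) = subst P (linDer B (X j)) := by
      have h1 : linDer A (subst P (X j)) = ∑ i, (A * P) i j • X i := by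
        rw [← linDer_linDer_X]; simp
      have h2 : subst P (linDer B (X j)) = ∑ i, (P * B) i j • X i := by
        have := subst_subst P B (X j)
        simpa using this
      rw [h1, h2, h]
    simp only [map_mul, Derivation.leibniz, map_add, smul_eq_mul, hp, key]

theorem coeff_linDer_diagonal (d : Fin n → ℂ) (p : MvPolynomial (Fin n) ℂ) (α : Fin n →₀ ℕ) :
    coeff α (linDer (diagonal d) p) = (∑ k, (α k : ℂ) * d k) * coeff α p := by
  induction p using MvPolynomial.induction_on' with
  | add p q hp hq => simp [hp, hq, mul_add]
  | monomial β a =>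
    have h : linDer (diagonal d) (monomial β a) = (∑ k, (β k : ℂ) * d k) • monomial β a := by
      rw [linDer, mkDerivation_monomial, Finsupp.sum_fintype _ _ (by simp), Finset.smul_sum,
        Finset.sum_smul]
      refine Finset.sum_congr rfl fun k _ => ?_
      have h0 : (∑ i, diagonal d i k • X i : MvPolynomial (Fin n) ℂ) = d k • X k := by
        simp [diagonal_apply]
      rw [h0]
      rcases Nat.eq_zero_or_pos (β k) with hk | hk
      · simp [hk]
      · have : β = β - Finsupp.single k 1 + Finsupp.single k 1 := by
          rw [tsub_add_cancel_of_le]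
          simpa using Nat.succ_le_of_lt hk
        rw [show monomial β a = monomial (β - Finsupp.single k 1 + Finsupp.single k 1) a from
          congrArg (fun γ => monomial γ a) this]
        simp only [smul_eq_mul, X, smul_monomial, monomial_mul]
        congr 1
        ring
    rw [h, coeff_smul, coeff_monomial]
    split_ifs with hβ
    · subst hβ; simp
    · simp

/-- A nilpotent matrix acts locally nilpotently on polynomials. -/
theorem exists_linDer_pow_eq_zero {N : Matrix (Fin n) (Fin n) ℂ} (hN : IsNilpotent N)
    (p : MvPolynomial (Fin n) ℂ) : ∃ k, (⇑(linDer N))^[k] p = 0 := by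
  have hz : ∀ k, (⇑(linDer N))^[k] 0 = 0 := fun k => Function.iterate_fixed (map_zero _) k
  have hle : ∀ {k l : ℕ} {p}, k ≤ l → (⇑(linDer N))^[k] p = 0 → (⇑(linDer N))^[l] p = 0 := by
    intro k l p hkl h
    obtain ⟨m, rfl⟩ := Nat.exists_eq_add_of_le hkl
    rw [add_comm, Function.iterate_add_apply, h, hz]
  have hadd : ∀ k p q, (⇑(linDer N))^[k] (p + q) = (⇑(linDer N))^[k] p + (⇑(linDer N))^[k] q := by
    intro k
    induction k with
    | zero => simp
    | succ k ih => intro p q; simp [Function.iterate_succ_apply, ih]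
  -- Each use of the Leibniz rule lowers one of the two exponents by one, hence the induction on
  -- their sum.
  have hmul : ∀ m k l : ℕ, k + l = m → ∀ p q, (⇑(linDer N))^[k] p = 0 → (⇑(linDer N))^[l] q = 0 →
      (⇑(linDer N))^[m] (p * q) = 0 := by
    intro m
    induction m with
    | zero =>
      intro k l hkl p q hp hq
      obtain rfl : k = 0 := by omega
      simp only [Function.iterate_zero, id] at hp
      simp [hp]
    | succ m ih =>
      intro k l hkl p q hp hq
      rcases k with _ | k
      · simp only [Function.iterate_zero, id] at hp
        simp [hp]
      rcases l with _ | l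
      · simp only [Function.iterate_zero, id] at hq
        simp [hq]
      rw [Function.iterate_succ_apply, Derivation.leibniz, hadd, smul_eq_mul, smul_eq_mul,
        ih (k + 1) l (by omega) p _ hp (by simpa using hq), mul_comm,
        ih k (l + 1) (by omega) _ q (by simpa using hp) hq, add_zero]
  induction p using MvPolynomial.induction_on with
  | C a => exact ⟨1, by simp [← algebraMap_eq]⟩
  | add p q hp hq =>
    obtain ⟨k, hk⟩ := hp
    obtain ⟨l, hl⟩ := hq
    exact ⟨k + l, by rw [hadd, hle (Nat.le_add_right k l) hk, hle (Nat.le_add_left l k) hl,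
      add_zero]⟩
  | mul_X p j hp =>
    obtain ⟨k, hk⟩ := hp
    obtain ⟨l, hl⟩ := hN
    have hX : ∀ m, (⇑(linDer N))^[m] (X j) = ∑ i, (N ^ m) i j • X i := by
      intro m
      induction m with
      | zero => simp [Matrix.one_apply]
      | succ m ih =>
        rw [Function.iterate_succ_apply', ih, pow_succ', ← linDer_linDer_X, linDer_X]
    exact ⟨k + l, hmul _ k l rfl p _ hk (by rw [hX, hl]; simp)⟩

/-- An eigenvector of a commuting sum of a diagonalizable and a nilpotent matrix is an
eigenvector of the diagonalizable part and is annihilated by the nilpotent part. -/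
theorem linDer_eq_of_diagonalizable_add_nilpotent {S N P : Matrix (Fin n) (Fin n) ℂ}
    {d : Fin n → ℂ} (hP : IsUnit P.det) (hS : S = P * diagonal d * P⁻¹) (hN : IsNilpotent N)
    (hSN : Commute S N) {c : ℂ} {p : MvPolynomial (Fin n) ℂ} (h : linDer (S + N) p = c • p) :
    linDer S p = c • p ∧ linDer N p = 0 := by
  have hSP : S * P = P * diagonal d := by
    rw [hS, Matrix.mul_assoc, Matrix.nonsing_inv_mul _ hP, Matrix.mul_one]
  obtain ⟨g, rfl⟩ : ∃ g, p = subst P g :=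
    ⟨subst P⁻¹ p, by rw [subst_subst, Matrix.mul_nonsing_inv _ hP, subst_one]⟩
  have hinj : Function.Injective (subst P) := by
    intro a b hab
    have := congrArg (subst P⁻¹) hab
    simpa [subst_subst, Matrix.nonsing_inv_mul _ hP, subst_one] using this
  -- On p the operator S - c equals -N. The two commute, so a power of S - c kills p; since S - c is
  -- diagonal on monomials in suitable coordinates, S - c itself kills p.
  let T : Module.End ℂ (MvPolynomial (Fin n) ℂ) := (linDer S : _ →ₗ[ℂ] _) - c • 1
  let D : Module.End ℂ (MvPolynomial (Fin n) ℂ) := (linDer N : _ →ₗ[ℂ] _)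
  have hcomm : Commute T D := by
    have h0 : ⁅linDer S, linDer N⁆ = 0 := by
      rw [← linDer_lie, Ring.lie_def, hSN.eq, sub_self, linDer_zero]
    refine Commute.sub_left ?_ ((Commute.one_left D).smul_left c)
    refine LinearMap.ext fun q => ?_
    have := DFunLike.congr_fun h0 q
    rw [Derivation.commutator_apply] at this
    exact sub_eq_zero.mp this
  have hT : T (subst P g) = -D (subst P g) := by
    have : linDer S (subst P g) + linDer N (subst P g) = c • subst P g := by
      rw [← h, linDer_add]; rfl
    simp only [T, D, LinearMap.sub_apply, LinearMap.smul_apply, Module.End.one_apply,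
      Derivation.coeFn_coe]
    rw [← this]; abel
  have hTk : ∀ k, (T ^ k) (subst P g) = (-1 : ℂ) ^ k • (D ^ k) (subst P g) := by
    intro k
    induction k with
    | zero => simp
    | succ k ih =>
      rw [pow_succ', Module.End.mul_apply, ih, map_smul, ← Module.End.mul_apply,
        (hcomm.pow_right k).eq, Module.End.mul_apply, hT, pow_succ D, Module.End.mul_apply,
        map_neg, pow_succ]
      simp
  obtain ⟨k, hk⟩ := exists_linDer_pow_eq_zero hN (subst P g)
  have hDk : (D ^ k) (subst P g) = 0 := by rw [Module.End.pow_apply]; exact hk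
  have hz : (T ^ k) (subst P g) = 0 := by rw [hTk, hDk, smul_zero]
  let T' : Module.End ℂ (MvPolynomial (Fin n) ℂ) := (linDer (diagonal d) : _ →ₗ[ℂ] _) - c • 1
  have hTT' : ∀ q, T (subst P q) = subst P (T' q) := by
    intro q
    simp [T, T', linDer_subst hSP]
  have hTT'k : ∀ k, (T ^ k) (subst P g) = subst P ((T' ^ k) g) := by
    intro k
    induction k with
    | zero => simp
    | succ k ih => rw [pow_succ', Module.End.mul_apply, ih, hTT', pow_succ', Module.End.mul_apply]
  have hco : ∀ q α, coeff α (T' q) = ((∑ k, (α k : ℂ) * d k) - c) * coeff α q := by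
    intro q α
    simp [T', coeff_linDer_diagonal, sub_mul]
  have hcok : ∀ k α, coeff α ((T' ^ k) g) = ((∑ k, (α k : ℂ) * d k) - c) ^ k * coeff α g := by
    intro k α
    induction k with
    | zero => simp
    | succ k ih => rw [pow_succ', Module.End.mul_apply, hco, ih]; ring
  have hT'g : T' g = 0 := by
    have h1 : (T' ^ k) g = 0 := hinj (by rw [← hTT'k, hz, map_zero])
    ext α
    have h2 := hcok k α
    rw [h1, coeff_zero] at h2
    rw [hco, coeff_zero]
    rcases mul_eq_zero.mp h2.symm with h3 | h3
    · rw [eq_zero_of_pow_eq_zero h3, zero_mul]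
    · rw [h3, mul_zero]
  have hfin : T (subst P g) = 0 := by rw [hTT', hT'g, map_zero]
  refine ⟨?_, ?_⟩
  · exact sub_eq_zero.mp hfin
  · rw [hT] at hfin
    exact neg_eq_zero.mp hfin

theorem linDer_eq_zero_of_isNilpotent {N : Matrix (Fin n) (Fin n) ℂ} (hN : IsNilpotent N)
    {c : ℂ} {p : MvPolynomial (Fin n) ℂ} (h : linDer N p = c • p) : linDer N p = 0 :=
  (linDer_eq_of_diagonalizable_add_nilpotent (S := 0) (P := 1) (d := 0) (by simp) (by simp) hN
    (Commute.zero_left N) (by rwa [zero_add])).2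

/-! ### The derivative of the discriminant. -/

/-- A derivation amounts to the ring homomorphism r ↦ r + ε D(r) into the dual numbers. It sends M
to (1 + εC) M (1 + εA), and det(1 + εB) = 1 + ε tr B. -/
theorem derivation_det {R : Type*} [CommRing R] [Algebra ℂ R] (D : Derivation ℂ R R)
    {M C A : Matrix (Fin n) (Fin n) R} (h : M.map D = C * M + M * A) :
    D M.det = (C.trace + A.trace) * M.det := by
  let φ : R →+* DualNumber R :=
    { toFun := fun r => (TrivSqZeroExt.inl r + TrivSqZeroExt.inr (D r) : TrivSqZeroExt R R)
      map_one' := by simp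
      map_mul' := fun a b => by ext <;> simp [mul_comm]
      map_zero' := by simp
      map_add' := fun a b => by ext <;> simp }
  let ι : R →+* DualNumber R := TrivSqZeroExt.inlHom R R
  have hε : (DualNumber.eps : DualNumber R) * DualNumber.eps = 0 := DualNumber.eps_mul_eps
  have hφ : ∀ r, φ r = ι r + DualNumber.eps * ι (D r) := by
    intro r
    ext <;> simp [φ, ι]
  have hM : φ.mapMatrix M = (1 + (DualNumber.eps : DualNumber R) • ι.mapMatrix C) *
      ι.mapMatrix M * (1 + (DualNumber.eps : DualNumber R) • ι.mapMatrix A) := by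
    have h1 : φ.mapMatrix M = ι.mapMatrix M + (DualNumber.eps : DualNumber R) •
        ι.mapMatrix (M.map D) := by
      refine Matrix.ext fun i j => ?_
      simp only [RingHom.mapMatrix_apply, Matrix.map_apply, Matrix.add_apply, Matrix.smul_apply,
        hφ, smul_eq_mul]
    rw [h1, h, map_add, map_mul, map_mul]
    simp only [add_mul, mul_add, one_mul, mul_one, smul_mul_assoc, mul_smul_comm, smul_smul, hε,
      zero_smul, add_zero, smul_add, add_assoc]
  have hdet := congrArg Matrix.det hM
  have hone : ∀ B : Matrix (Fin n) (Fin n) (DualNumber R),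
      (1 + (DualNumber.eps : DualNumber R) • B).det = 1 + B.trace * DualNumber.eps := by
    intro B
    rw [det_one_add_smul, pow_two, hε, mul_zero, add_zero]
  rw [← RingHom.map_det, det_mul, det_mul, hone, hone, ← RingHom.map_det] at hdet
  have htr : ∀ B : Matrix (Fin n) (Fin n) R, (ι.mapMatrix B).trace = ι B.trace := by
    intro B; simp [Matrix.trace]
  rw [htr, htr, hφ] at hdet
  have := congrArg TrivSqZeroExt.snd hdet
  simp [ι] at this
  rw [this]; ring

/-- The polynomial `det (δᵢ(xⱼ))`. -/
noncomputable def discrPoly (δ : Fin n → Matrix (Fin n) (Fin n) ℂ) : MvPolynomial (Fin n) ℂ :=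
  (Matrix.of fun i j => linDer (δ i) (X j)).det

theorem eval_linDer_X (A : Matrix (Fin n) (Fin n) ℂ) (x : Fin n → ℂ) (j : Fin n) :
    eval x (linDer A (X j)) = lin A x j := by
  simp [lin, Matrix.vecMul, dotProduct, mul_comm, smul_eval]

theorem eval_discrPoly (δ : Fin n → Matrix (Fin n) (Fin n) ℂ) (x : Fin n → ℂ) :
    eval x (discrPoly δ) = discr δ x := by
  rw [discrPoly, RingHom.map_det, discr]
  congr 1
  ext i j
  simp only [RingHom.mapMatrix_apply, Matrix.map_apply, Matrix.of_apply, eval_linDer_X]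

/-- The identity A(δᵢ(xⱼ)) = [A, δᵢ](xⱼ) + δᵢ(A(xⱼ)) puts the coefficient matrix in the form
required by `derivation_det`. -/
theorem linDer_discrPoly {δ : Fin n → Matrix (Fin n) (Fin n) ℂ} {A C : Matrix (Fin n) (Fin n) ℂ}
    (h : ∀ i, ⁅A, δ i⁆ = ∑ k, C i k • δ k) :
    linDer A (discrPoly δ) = (C.trace + A.trace) • discrPoly δ := by
  have key : (Matrix.of fun i j => linDer (δ i) (X j : MvPolynomial (Fin n) ℂ)).map (linDer A) =
      C.map MvPolynomial.C * (Matrix.of fun i j => linDer (δ i) (X j)) +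
        (Matrix.of fun i j => linDer (δ i) (X j)) * A.map MvPolynomial.C := by
    refine Matrix.ext fun i j => ?_
    have h1 : linDer A (linDer (δ i) (X j)) =
        linDer ⁅A, δ i⁆ (X j) + linDer (δ i) (linDer A (X j)) := by
      rw [linDer_lie, Derivation.commutator_apply]; abel
    have h2 : ∀ (c : Fin n → ℂ) q, linDer (∑ k, c k • δ k) q = ∑ k, c k • linDer (δ k) q := by
      intro c q
      let L : Matrix (Fin n) (Fin n) ℂ →ₗ[ℂ] MvPolynomial (Fin n) ℂ :=
        { toFun := fun B => linDer B q
          map_add' := fun A B => by rw [linDer_add]; rfl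
          map_smul' := fun a B => by rw [linDer_smul]; rfl }
      change L _ = ∑ k, c k • L _
      simp only [map_sum, map_smul]
    simp only [Matrix.map_apply, Matrix.of_apply, Matrix.add_apply, Matrix.mul_apply]
    rw [h1, h, h2, linDer_X A]
    simp only [map_sum, Derivation.map_smul]
    simp only [smul_eq_C_mul, mul_comm]
  rw [discrPoly, derivation_det _ key, smul_eq_C_mul]
  congr 1
  simp [Matrix.trace]

theorem hasFDerivAt_eval (p : MvPolynomial (Fin n) ℂ) (x : Fin n → ℂ) :
    ∃ p' : (Fin n → ℂ) →L[ℂ] ℂ, HasFDerivAt (fun y => eval y p) p' x ∧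
      ∀ A : Matrix (Fin n) (Fin n) ℂ, p' (lin A x) = eval x (linDer A p) := by
  induction p using MvPolynomial.induction_on with
  | C a => exact ⟨0, by simpa using hasFDerivAt_const a x, fun A => by simp [← algebraMap_eq]⟩
  | add p q hp hq =>
    obtain ⟨p', hp, hp'⟩ := hp
    obtain ⟨q', hq, hq'⟩ := hq
    exact ⟨p' + q', by simpa using! hp.add hq, fun A => by simp [hp', hq']⟩
  | mul_X p j hp =>
    obtain ⟨p', hp, hp'⟩ := hp
    refine ⟨_, by simpa using! hp.mul (hasFDerivAt_apply (𝕜 := ℂ) j x), fun A => ?_⟩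
    simp only [Derivation.leibniz, _root_.add_apply, _root_.smul_apply,
      ContinuousLinearMap.proj_apply, hp', smul_eq_mul, map_add, map_mul, eval_X, eval_linDer_X]

theorem act_eval (p : MvPolynomial (Fin n) ℂ) (A : Matrix (Fin n) (Fin n) ℂ) (x : Fin n → ℂ) :
    act (lin A) (fun y => eval y p) x = eval x (linDer A p) := by
  obtain ⟨p', h, h'⟩ := hasFDerivAt_eval p x
  rw [act, h.fderiv, h']

theorem act_discr_eq_zero_iff (δ : Fin n → Matrix (Fin n) (Fin n) ℂ)
    (A : Matrix (Fin n) (Fin n) ℂ) :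
    (∀ x, act (lin A) (discr δ) x = 0) ↔ linDer A (discrPoly δ) = 0 := by
  have : discr δ = fun y => eval y (discrPoly δ) := funext fun y => (eval_discrPoly δ y).symm
  simp only [this, act_eval]
  exact ⟨fun h => MvPolynomial.funext fun x => by simpa using h x, fun h x => by simp [h]⟩

/-! ### Diagonalizable matrices, their adjoint action and Jordan parts. -/

/-- The map `d ↦ P diag(d) P⁻¹`. -/
noncomputable def conjDiag (P : Matrix (Fin n) (Fin n) ℂ) :
    (Fin n → ℂ) →ₗ[ℂ] Matrix (Fin n) (Fin n) ℂ where
  toFun d := P * diagonal d * P⁻¹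
  map_add' d e := by rw [← Matrix.add_mul, ← Matrix.mul_add, diagonal_add]; rfl
  map_smul' c d := by
    rw [RingHom.id_apply, ← Matrix.smul_mul, ← Matrix.mul_smul, ← diagonal_smul]

theorem conjDiag_apply (P : Matrix (Fin n) (Fin n) ℂ) (d : Fin n → ℂ) :
    conjDiag P d = P * diagonal d * P⁻¹ := rfl

theorem conjDiag_mul {P : Matrix (Fin n) (Fin n) ℂ} (hP : IsUnit P.det) (d e : Fin n → ℂ) :
    conjDiag P (d * e) = conjDiag P d * conjDiag P e := by
  have : diagonal (d * e) = diagonal d * diagonal e := (diagonal_mul_diagonal d e).symm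
  simp only [conjDiag_apply, this, Matrix.mul_assoc]
  rw [← Matrix.mul_assoc P⁻¹ P, Matrix.nonsing_inv_mul _ hP, Matrix.one_mul]

theorem conjDiag_one {P : Matrix (Fin n) (Fin n) ℂ} (hP : IsUnit P.det) :
    conjDiag P 1 = 1 := by
  have : diagonal (1 : Fin n → ℂ) = 1 := diagonal_one
  rw [conjDiag_apply, this, Matrix.mul_one, Matrix.mul_nonsing_inv _ hP]

theorem conjDiag_injective {P : Matrix (Fin n) (Fin n) ℂ} (hP : IsUnit P.det) :
    Function.Injective (conjDiag P) := by
  intro d e h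
  have h1 := congrArg (fun Y => P⁻¹ * Y * P) h
  simp only [conjDiag_apply, ← Matrix.mul_assoc, Matrix.nonsing_inv_mul _ hP,
    Matrix.one_mul] at h1
  simp only [Matrix.mul_assoc, Matrix.nonsing_inv_mul _ hP, Matrix.mul_one] at h1
  exact diagonal_injective h1

theorem commute_conjDiag {P : Matrix (Fin n) (Fin n) ℂ} (hP : IsUnit P.det) (d e : Fin n → ℂ) :
    Commute (conjDiag P d) (conjDiag P e) := by
  rw [commute_iff_eq, ← conjDiag_mul hP, mul_comm, conjDiag_mul hP]

/-- The product of X - c over the distinct entries c of d is squarefree and kills d. Stated for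
algebra homomorphisms out of ℂⁿ, this covers conjugates of diagonal matrices as well as left and
right multiplication by them. -/
theorem isSemisimple_algHom_pi {V : Type*} [AddCommGroup V] [Module ℂ V]
    (ψ : (Fin n → ℂ) →ₐ[ℂ] Module.End ℂ V) (d : Fin n → ℂ) : (ψ d).IsSemisimple := by
  refine Module.End.isSemisimple_of_squarefree_aeval_eq_zero
    (p := ∏ c ∈ Finset.univ.image d, (Polynomial.X - Polynomial.C c)) ?_ ?_
  · exact (Polynomial.separable_prod_X_sub_C_iff'.mpr fun x _ y _ h => h).squarefree
  · rw [Polynomial.aeval_algHom_apply]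
    convert map_zero ψ
    ext k
    rw [map_prod, Finset.prod_apply]
    exact Finset.prod_eq_zero (Finset.mem_image_of_mem d (Finset.mem_univ k)) (by simp)

theorem isSemisimple_conjDiag {P : Matrix (Fin n) (Fin n) ℂ} (hP : IsUnit P.det)
    (d : Fin n → ℂ) : Module.End.IsSemisimple (Matrix.toLin' (conjDiag P d)) :=
  isSemisimple_algHom_pi
    ((Matrix.toLinAlgEquiv' : Matrix (Fin n) (Fin n) ℂ ≃ₐ[ℂ] _).toAlgHom.comp
      (AlgHom.ofLinearMap (conjDiag P) (conjDiag_one hP) (conjDiag_mul hP))) d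

/-- The map `ad A` on matrices. -/
noncomputable def matAd (A : Matrix (Fin n) (Fin n) ℂ) :
    Module.End ℂ (Matrix (Fin n) (Fin n) ℂ) :=
  LinearMap.mulLeft ℂ A - LinearMap.mulRight ℂ A

theorem matAd_apply (A B : Matrix (Fin n) (Fin n) ℂ) : matAd A B = ⁅A, B⁆ := rfl

theorem isSemisimple_matAd_conjDiag {P : Matrix (Fin n) (Fin n) ℂ} (hP : IsUnit P.det)
    (d : Fin n → ℂ) : (matAd (conjDiag P d)).IsSemisimple := by
  have h1 := isSemisimple_algHom_pi
    (AlgHom.ofLinearMap ((LinearMap.mul ℂ (Matrix (Fin n) (Fin n) ℂ)).comp (conjDiag P))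
      (by ext1 A; simp [conjDiag_one hP])
      (fun d e => by ext1 A; simp [conjDiag_mul hP, Matrix.mul_assoc])) d
  have h2 := isSemisimple_algHom_pi
    (AlgHom.ofLinearMap ((LinearMap.mul ℂ (Matrix (Fin n) (Fin n) ℂ)).flip.comp (conjDiag P))
      (by ext1 A; simp [conjDiag_one hP])
      (fun d e => by ext1 A; simp [mul_comm d e, conjDiag_mul hP, Matrix.mul_assoc])) d
  exact h1.sub_of_commute (LinearMap.ext fun A => by simp [Matrix.mul_assoc]) h2

theorem commute_matAd {A B : Matrix (Fin n) (Fin n) ℂ} (h : Commute A B) :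
    Commute (matAd A) (matAd B) := by
  refine LinearMap.ext fun Y => ?_
  change ⁅A, ⁅B, Y⁆⁆ = ⁅B, ⁅A, Y⁆⁆
  simp only [Ring.lie_def, mul_sub, sub_mul, ← mul_assoc]
  rw [h.eq, mul_assoc Y A B, h.eq, ← mul_assoc]
  abel

/-- A subspace stable under pairwise commuting semisimple endomorphisms is spanned by joint
eigenvectors. -/
theorem le_span_joint_eigenvectors {V ι : Type*} [AddCommGroup V] [Module ℂ V]
    [FiniteDimensional ℂ V] (F : ι → Module.End ℂ V) (hF : ∀ i, (F i).IsSemisimple)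
    (hc : ∀ i j, Commute (F i) (F j)) (W : Submodule ℂ V) (hW : ∀ i, ∀ v ∈ W, F i v ∈ W) :
    W ≤ Submodule.span ℂ {v | v ∈ W ∧ ∀ i, ∃ μ : ℂ, F i v = μ • v} := by
  let g : ι → Module.End ℂ W := fun i => (F i).restrict (hW i)
  have hg : ∀ i, (g i).IsSemisimple := fun i =>
    Module.End.isFinitelySemisimple_iff_isSemisimple.mp ((hF i).isFinitelySemisimple.restrict _)
  have htop :=
    Module.End.iSup_iInf_maxGenEigenspace_eq_top_of_iSup_maxGenEigenspace_eq_top_of_commute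
      g (fun i j _ => LinearMap.ext fun v => Subtype.ext (LinearMap.congr_fun (hc i j).eq v))
      (fun i => (hg i).isFinitelySemisimple.iSup_maxGenEigenspace_eq_top_iff.mpr
        (hg i).iSup_eigenspace_eq_top)
  have hle : (⊤ : Submodule ℂ W) ≤
      (Submodule.span ℂ {v | v ∈ W ∧ ∀ i, ∃ μ : ℂ, F i v = μ • v}).comap W.subtype := by
    rw [← htop]
    refine iSup_le fun χ v hv => Submodule.subset_span ⟨v.2, fun i => ⟨χ i, ?_⟩⟩
    have := (Submodule.mem_iInf _).mp hv i
    rw [(hg i).isFinitelySemisimple.maxGenEigenspace_eq_eigenspace] at this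
    exact congrArg Subtype.val (Module.End.mem_eigenspace_iff.mp this)
  exact fun v hv => hle (Submodule.mem_top (x := ⟨v, hv⟩))

/-- Pairwise commuting semisimple complex matrices are simultaneously diagonalizable. -/
theorem exists_simultaneous_diagonalization {ι : Type*} (F : ι → Matrix (Fin n) (Fin n) ℂ)
    (hF : ∀ i, Module.End.IsSemisimple (Matrix.toLin' (F i)))
    (hc : ∀ i j, Commute (F i) (F j)) :
    ∃ P : Matrix (Fin n) (Fin n) ℂ, IsUnit P.det ∧ ∃ d : ι → Fin n → ℂ,
      ∀ i, F i = conjDiag P (d i) := by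
  let f : ι → Module.End ℂ (Fin n → ℂ) := fun i => Matrix.toLin' (F i)
  let E : Set (Fin n → ℂ) := {v | v ∈ (⊤ : Submodule ℂ _) ∧ ∀ i, ∃ μ : ℂ, f i v = μ • v}
  have hE : Submodule.span ℂ E = ⊤ := by
    refine top_le_iff.mp (le_span_joint_eigenvectors f hF (fun i j => ?_) ⊤ (by simp))
    change f i * f j = f j * f i
    simp only [f, Module.End.mul_eq_comp, ← Matrix.toLin'_mul, (hc i j).eq]
  have hfr : Module.finrank ℂ (Submodule.span ℂ E) = n := by
    rw [hE, finrank_top, Module.finrank_fin_fun]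
  obtain ⟨b, hbE, -, hbl⟩ := hfr ▸ Submodule.exists_fun_fin_finrank_span_eq ℂ E
  choose _ μ hμ using hbE
  have hP : IsUnit (Matrix.of fun k i => b i k).det := by
    rw [← Matrix.isUnit_iff_isUnit_det, ← Matrix.linearIndependent_cols_iff_isUnit]
    exact hbl
  refine ⟨_, hP, fun i k => μ k i, fun i => ?_⟩
  have : F i * (Matrix.of fun k i => b i k) =
      (Matrix.of fun k i => b i k) * diagonal (fun k => μ k i) := by
    ext k l
    have := congrFun (hμ l i) k
    simp only [f, Matrix.toLin'_apply, Matrix.mulVec, dotProduct, Pi.smul_apply,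
      smul_eq_mul] at this
    rw [Matrix.mul_diagonal, Matrix.mul_apply]
    simpa [mul_comm] using this
  rw [conjDiag_apply, ← this, Matrix.mul_assoc, Matrix.mul_nonsing_inv _ hP, Matrix.mul_one]

/-- The solution space of a system of rational linear equations is spanned by rational vectors. -/
theorem exists_rational_basis {κ : Type*} (α : κ → Fin n → ℚ) :
    ∃ (r : ℕ) (w : Fin r → Fin n → ℚ),
      LinearIndependent ℂ (fun i k => (w i k : ℂ)) ∧
      ∀ d : Fin n → ℂ, d ∈ Submodule.span ℂ (Set.range fun i k => (w i k : ℂ)) ↔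
        ∀ a, ∑ k, (α a k : ℂ) * d k = 0 := by
  let S : Set (Fin n → ℂ) :=
    {v | ∃ u : Fin n → ℚ, (∀ a, ∑ k, α a k * u k = 0) ∧ v = fun k => (u k : ℂ)}
  obtain ⟨b, hbS, hbs, hbl⟩ := Submodule.exists_fun_fin_finrank_span_eq ℂ S
  choose w hw hbw using hbS
  have hb : b = fun i k => (w i k : ℂ) := funext hbw
  refine ⟨_, w, hb ▸ hbl, fun d => ?_⟩
  rw [← hb, hbs]
  constructor
  · intro hd a
    induction hd using Submodule.span_induction with
    | mem v hv =>
      obtain ⟨u, hu, rfl⟩ := hv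
      simpa using congrArg (fun t : ℚ => (t : ℂ)) (hu a)
    | zero => simp
    | add u v _ _ hu hv => simp [mul_add, Finset.sum_add_distrib, hu, hv]
    | smul c v _ hv =>
      rw [← mul_zero c, ← hv, Finset.mul_sum]
      exact Finset.sum_congr rfl fun k _ => by simp [mul_left_comm]
  · intro hd
    -- Expand a complex solution in a ℚ-basis of ℂ. The equations are rational, so they hold for
    -- each coordinate separately, and each coordinate vector is a rational solution.
    let B := Module.Basis.ofVectorSpace ℚ ℂ
    let J := Finset.univ.biUnion fun k => (B.repr (d k)).support
    have hsum : d = ∑ j ∈ J, B j • fun k => ((B.repr (d k) j : ℚ) : ℂ) := by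
      funext k
      conv_lhs => rw [← B.linearCombination_repr (d k), Finsupp.linearCombination_apply]
      rw [Finsupp.sum_of_support_subset (s := J) _
        (Finset.subset_biUnion_of_mem (fun k => (B.repr (d k)).support) (Finset.mem_univ k)) _
        (by simp)]
      simp [Rat.smul_def, mul_comm]
    rw [hsum]
    refine Submodule.sum_mem _ fun j _ => Submodule.smul_mem _ _ (Submodule.subset_span ?_)
    refine ⟨fun k => B.repr (d k) j, fun a => ?_, rfl⟩
    have h1 : ∑ k, α a k • d k = 0 := by simpa [Rat.smul_def] using hd a
    have h2 := congrArg (fun z => B.repr z j) h1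
    simpa using h2

/-- The eigenvalues of `ad σ`, for `σ` diagonalizable, are differences of eigenvalues of `σ`. -/
theorem exists_eq_sub_of_lie_eq_smul {P : Matrix (Fin n) (Fin n) ℂ} (hP : IsUnit P.det)
    (w : Fin n → ℂ) {A : Matrix (Fin n) (Fin n) ℂ} (hA : A ≠ 0) {q : ℂ}
    (h : ⁅conjDiag P w, A⁆ = q • A) : ∃ a b, w a - w b = q := by
  by_contra! hcon
  have hz : P⁻¹ * A * P = 0 := by
    ext a b
    have h1 := congrArg (fun Y => P⁻¹ * Y * P) h
    have h2 : P⁻¹ * (conjDiag P w * A) * P = diagonal w * (P⁻¹ * A * P) := by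
      simp only [conjDiag_apply, ← Matrix.mul_assoc, Matrix.nonsing_inv_mul _ hP, Matrix.one_mul]
    have h3 : P⁻¹ * (A * conjDiag P w) * P = (P⁻¹ * A * P) * diagonal w := by
      simp only [conjDiag_apply, Matrix.mul_assoc, Matrix.nonsing_inv_mul _ hP, Matrix.mul_one]
    simp only [Ring.lie_def, Matrix.mul_sub, Matrix.sub_mul, h2, h3, Matrix.mul_smul,
      Matrix.smul_mul] at h1
    have h4 := congrFun (congrFun h1 a) b
    simp only [Matrix.diagonal_mul, Matrix.sub_apply, Matrix.mul_diagonal, Matrix.smul_apply,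
      smul_eq_mul] at h4
    have h5 : (w a - w b - q) * (P⁻¹ * A * P) a b = 0 := by linear_combination h4
    simpa using (mul_eq_zero.mp h5).resolve_left (sub_ne_zero.mpr (hcon a b))
  have : A = P * (P⁻¹ * A * P) * P⁻¹ := by
    simp only [← Matrix.mul_assoc, Matrix.mul_nonsing_inv _ hP, Matrix.one_mul]
    rw [Matrix.mul_assoc, Matrix.mul_nonsing_inv _ hP, Matrix.mul_one]
  exact hA (by rw [this, hz, Matrix.mul_zero, Matrix.zero_mul])

/-- An eigenvector of `ad σ` with non-zero eigenvalue, for `σ` diagonalizable, is nilpotent. -/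
theorem isNilpotent_of_lie_eq_smul {P : Matrix (Fin n) (Fin n) ℂ} (hP : IsUnit P.det)
    (w : Fin n → ℂ) {A : Matrix (Fin n) (Fin n) ℂ} {q : ℂ} (hq : q ≠ 0)
    (h : ⁅conjDiag P w, A⁆ = q • A) : IsNilpotent A := by
  have hDA : conjDiag P w * A = A * conjDiag P w + q • A := by rw [← h, Ring.lie_def]; abel
  have hpow : ∀ k : ℕ, conjDiag P w * A ^ k = A ^ k * conjDiag P w + ((k : ℂ) * q) • A ^ k := by
    intro k
    induction k with
    | zero => simp
    | succ k ih =>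
      rw [pow_succ, ← Matrix.mul_assoc, ih, Matrix.add_mul, Matrix.mul_assoc (A ^ k) _ A, hDA,
        Matrix.mul_add, smul_mul_assoc, Matrix.mul_smul, Matrix.mul_assoc (A ^ k) A _, add_assoc,
        ← add_smul]
      push_cast
      congr 2
      ring
  -- If no power of A vanished, every k q would be an eigenvalue of ad σ, but the differences of
  -- entries of w are finite in number.
  by_contra hcon
  have hne : ∀ k, A ^ k ≠ 0 := fun k hk => hcon ⟨k, hk⟩
  refine Set.infinite_univ (α := ℕ) (Set.Finite.of_finite_image
    (f := fun k : ℕ => (k : ℂ) * q) (Set.Finite.subset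
      (Set.finite_range fun ab : Fin n × Fin n => w ab.1 - w ab.2)
      (Set.image_subset_iff.mpr fun k _ => ?_)) ?_)
  · obtain ⟨a, b, hab⟩ := exists_eq_sub_of_lie_eq_smul hP w (hne k) (q := k * q)
      (by rw [Ring.lie_def, hpow k, add_sub_cancel_left])
    exact ⟨(a, b), hab⟩
  · intro a _ b _ hab
    exact_mod_cast mul_right_cancel₀ hq hab

theorem exists_isJordanDecomposition (A : Matrix (Fin n) (Fin n) ℂ) :
    ∃ S N, IsJordanDecomposition A S N := by
  obtain ⟨N, hN, S, hS, hNn, hSs, h⟩ :=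
    Module.End.exists_isNilpotent_isSemisimple (f := Matrix.toLin' A)
  have hc : Commute N S := Algebra.commute_of_mem_adjoin_singleton_of_commute hS
    (Algebra.commute_of_mem_adjoin_singleton_of_commute hN (Commute.refl _)).symm
  let φ := (Matrix.toLinAlgEquiv' : Matrix (Fin n) (Fin n) ℂ ≃ₐ[ℂ] _)
  refine ⟨φ.symm S, φ.symm N, ?_, hc.symm.map φ.symm, ?_, hNn.map φ.symm⟩
  · apply φ.injective
    rw [map_add, φ.apply_symm_apply, φ.apply_symm_apply, add_comm, ← h]
    rfl
  · change Module.End.IsSemisimple (φ (φ.symm S))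
    rwa [φ.apply_symm_apply]

/-- By uniqueness of the decomposition, S is a polynomial in A. -/
theorem IsJordanDecomposition.commute_left {A S N B : Matrix (Fin n) (Fin n) ℂ}
    (h : IsJordanDecomposition A S N) (hB : Commute B A) : Commute B S := by
  obtain ⟨N', hN, S', hS, hNn, hSs, h'⟩ :=
    Module.End.exists_isNilpotent_isSemisimple (f := Matrix.toLin' A)
  have hc : Commute N' S' := Algebra.commute_of_mem_adjoin_singleton_of_commute hS
    (Algebra.commute_of_mem_adjoin_singleton_of_commute hN (Commute.refl _)).symm
  let φ := (Matrix.toLinAlgEquiv' : Matrix (Fin n) (Fin n) ℂ ≃ₐ[ℂ] _)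
  have huniq := (Module.End.isNilpotent_isSemisimple_unique (h.nilpotent.map φ) h.semisimple hNn hSs
    (h.commute.symm.map φ) hc (by
      rw [← h', h.eq_add, add_comm, map_add]
      rfl)).2
  have h1 : Commute (φ B) (φ S) := by
    change φ S = S' at huniq
    rw [huniq]
    exact Algebra.commute_of_mem_adjoin_singleton_of_commute hS (hB.map φ)
  exact φ.injective (by simpa using h1.eq)

/-! ### The Lie algebra of logarithmic fields of degree 0. -/

variable {f : (Fin n → ℂ) → ℂ}

theorem lin_add (A B : Matrix (Fin n) (Fin n) ℂ) (x : Fin n → ℂ) :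
    lin (A + B) x = lin A x + lin B x := Matrix.vecMul_add _ _ _

theorem lin_smul (c : ℂ) (A : Matrix (Fin n) (Fin n) ℂ) (x : Fin n → ℂ) :
    lin (c • A) x = c • lin A x := Matrix.vecMul_smul _ _ _

theorem lin_one (x : Fin n → ℂ) : lin 1 x = x := Matrix.vecMul_one x

theorem lin_sum {ι : Type*} (s : Finset ι) (A : ι → Matrix (Fin n) (Fin n) ℂ) (x : Fin n → ℂ) :
    lin (∑ i ∈ s, A i) x = ∑ i ∈ s, lin (A i) x := Matrix.vecMul_sum _ _ _

theorem lin_injective : Function.Injective (lin : Matrix (Fin n) (Fin n) ℂ → _) := by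
  intro A B h
  ext i j
  simpa [lin] using congrFun (congrFun h (Pi.single i 1)) j

/-- The vector field `lin A` as a continuous linear map. -/
noncomputable def linCLM (A : Matrix (Fin n) (Fin n) ℂ) : (Fin n → ℂ) →L[ℂ] (Fin n → ℂ) :=
  LinearMap.toContinuousLinearMap (Matrix.vecMulLinear A)

theorem linCLM_apply (A : Matrix (Fin n) (Fin n) ℂ) (x : Fin n → ℂ) : linCLM A x = lin A x := rfl

theorem analyticOnNhd_lin (A : Matrix (Fin n) (Fin n) ℂ) (U : Set (Fin n → ℂ)) :
    AnalyticOnNhd ℂ (lin A) U := (linCLM A).analyticOnNhd U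

/-- The matrices of the vector fields of degree `0` that are tangent to `{f = 0}`. -/
def tangentMatrices (f : (Fin n → ℂ) → ℂ) : Submodule ℂ (Matrix (Fin n) (Fin n) ℂ) where
  carrier := {A | ∀ x, f x = 0 → fderiv ℂ f x (lin A x) = 0}
  add_mem' hA hB x hx := by rw [lin_add, map_add, hA x hx, hB x hx, add_zero]
  zero_mem' x _ := by simp [lin]
  smul_mem' c A hA x hx := by rw [lin_smul, map_smul, hA x hx, smul_zero]

theorem analyticOnNhd_act (hf : AnalyticOnNhd ℂ f Set.univ) (A : Matrix (Fin n) (Fin n) ℂ) :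
    AnalyticOnNhd ℂ (act (lin A) f) Set.univ :=
  fun x hx => ((ContinuousLinearMap.apply ℂ ℂ).flip.analyticAt_bilinear
    (fderiv ℂ f x, lin A x)).comp₂ (hf.fderiv x hx) (analyticOnNhd_lin A _ x hx)

/-- Reducedness supplies the holomorphic quotient A(f)/f, so being logarithmic becomes a pointwise
condition, linear in A. -/
theorem isLogarithmic_lin_iff (hf : IsReducedEquation f) (A : Matrix (Fin n) (Fin n) ℂ) :
    IsLogarithmic f Set.univ (lin A) ↔ A ∈ tangentMatrices f := by
  constructor
  · rintro ⟨_, g, _, hg⟩ x hx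
    have := hg x (Set.mem_univ x)
    rwa [hx, mul_zero] at this
  · intro hA
    exact ⟨analyticOnNhd_lin A _, hf.reduced Set.univ _ isOpen_univ
      (analyticOnNhd_act hf.holomorphic A) fun x _ hx => hA x hx⟩

/-- If B(f) = b f, then A(B(f)) = A(b) f + b A(f) vanishes wherever f does; likewise with A and B
exchanged. -/
theorem lie_mem_tangentMatrices (hf : IsReducedEquation f) {A B : Matrix (Fin n) (Fin n) ℂ}
    (hA : A ∈ tangentMatrices f) (hB : B ∈ tangentMatrices f) : ⁅A, B⁆ ∈ tangentMatrices f := by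
  intro x hx
  have hA0 := hA x hx
  have hB0 := hB x hx
  obtain ⟨-, a, ha, hA⟩ := (isLogarithmic_lin_iff hf A).mpr hA
  obtain ⟨-, b, hb, hB⟩ := (isLogarithmic_lin_iff hf B).mpr hB
  have key : ∀ {C E : Matrix (Fin n) (Fin n) ℂ} {c : (Fin n → ℂ) → ℂ},
      AnalyticOnNhd ℂ c Set.univ → (∀ x ∈ Set.univ, act (lin C) f x = c x * f x) →
      fderiv ℂ f x (lin E x) = 0 →
      fderiv ℂ (fun y => fderiv ℂ f y (lin C y)) x (lin E x) = 0 := by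
    intro C E c hc hC hE
    have : (fun y => fderiv ℂ f y (lin C y)) = fun y => c y * f y :=
      funext fun y => hC y (Set.mem_univ y)
    rw [this, fderiv_fun_mul (hc x (Set.mem_univ x)).differentiableAt
      (hf.holomorphic x (Set.mem_univ x)).differentiableAt]
    simp [hx, hE]
  rw [← lieBracket_lin, VectorField.fderiv_apply_lieBracket (n := ⊤)
    (hf.holomorphic x (Set.mem_univ x)).contDiffAt (by simp)
    (analyticOnNhd_lin B _ x (Set.mem_univ x)).differentiableAt
    (analyticOnNhd_lin A _ x (Set.mem_univ x)).differentiableAt, key hb hB hA0, key ha hA hB0,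
    sub_zero]

theorem linearIndependent_of_isLogBasis {ι : Type} [Fintype ι]
    {b : ι → Matrix (Fin n) (Fin n) ℂ} (hb : IsLogBasis f Set.univ fun i => lin (b i)) :
    LinearIndependent ℂ b := by
  rw [Fintype.linearIndependent_iff]
  intro c hc i
  refine hb.2.2 (fun i _ => c i) (fun _ _ => 0) (fun _ => analyticOnNhd_const)
    (fun _ => analyticOnNhd_const) (fun x _ => ?_) i 0 (Set.mem_univ _)
  simp only [← lin_smul, ← lin_sum, hc]
  simp [lin]

/-- The holomorphic coefficients of a linear field may be replaced by their values at the origin: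
evaluate at t x, divide by t and let t tend to 0. -/
theorem span_eq_of_isLogBasis (hf : IsReducedEquation f) {ι : Type} [Fintype ι]
    {b : ι → Matrix (Fin n) (Fin n) ℂ} (hb : IsLogBasis f Set.univ fun i => lin (b i)) :
    Submodule.span ℂ (Set.range b) = tangentMatrices f := by
  apply le_antisymm
  · rw [Submodule.span_le]
    rintro _ ⟨i, rfl⟩
    exact (isLogarithmic_lin_iff hf _).mp (hb.1 i)
  · intro A hA
    obtain ⟨h, hh, hv⟩ := hb.2.1 _ ((isLogarithmic_lin_iff hf A).mpr hA)
    have hA0 : A = ∑ i, h i 0 • b i := by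
      apply lin_injective
      funext x
      simp only [lin_sum, lin_smul]
      have h1 : ∀ t : ℂ, t ≠ 0 → lin A x = ∑ i, h i (t • x) • lin (b i) x := by
        intro t ht
        have := hv (t • x) (Set.mem_univ _)
        simp only [lin, Matrix.smul_vecMul] at this
        rw [← smul_right_inj ht, lin, this, Finset.smul_sum]
        exact Finset.sum_congr rfl fun i _ => smul_comm _ _ _
      have h2 : Continuous fun t : ℂ => ∑ i, h i (t • x) • lin (b i) x := by
        have : ∀ i, Continuous (h i) := fun i => continuousOn_univ.mp (hh i).continuousOn
        fun_prop
      have h3 := (h2.tendsto 0).mono_left (nhdsWithin_le_nhds (s := {0}ᶜ))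
      have h4 : Tendsto (fun t : ℂ => ∑ i, h i (t • x) • lin (b i) x) (𝓝[≠] 0) (𝓝 (lin A x)) :=
        tendsto_const_nhds.congr' (eventually_nhdsWithin_of_forall h1)
      simpa using tendsto_nhds_unique h4 h3
    rw [hA0]
    exact Submodule.sum_mem _ fun i _ => Submodule.smul_mem _ _ (Submodule.subset_span ⟨i, rfl⟩)

/-- A basis of the space of logarithmic vector fields of degree `0` is a basis of the module of
logarithmic vector fields, provided that one such basis exists. -/
theorem IsLogBasis.of_span_eq (hf : IsReducedEquation f) {ι κ : Type} [Fintype ι] [Fintype κ]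
    {b : ι → Matrix (Fin n) (Fin n) ℂ} (hb : IsLogBasis f Set.univ fun i => lin (b i))
    {e : κ → Matrix (Fin n) (Fin n) ℂ} (he : LinearIndependent ℂ e)
    (hspan : Submodule.span ℂ (Set.range e) = tangentMatrices f) :
    IsLogBasis f Set.univ fun i => lin (e i) := by
  have hbspan := span_eq_of_isLogBasis hf hb
  have hbe : ∀ i, ∃ c : κ → ℂ, ∑ k, c k • e k = b i := fun i => by
    rw [← Submodule.mem_span_range_iff_exists_fun, hspan, ← hbspan]
    exact Submodule.subset_span ⟨i, rfl⟩
  have heb : ∀ k, ∃ c : ι → ℂ, ∑ i, c i • b i = e k := fun k => by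
    rw [← Submodule.mem_span_range_iff_exists_fun, hbspan, ← hspan]
    exact Submodule.subset_span ⟨k, rfl⟩
  choose R hR using hbe
  choose Q hQ using heb
  refine ⟨fun k => ?_, fun v hv => ?_, fun h h' hh hh' heq k x hx => ?_⟩
  · rw [isLogarithmic_lin_iff hf, ← hspan]
    exact Submodule.subset_span ⟨k, rfl⟩
  · obtain ⟨h, hh, hv⟩ := hb.2.1 v hv
    refine ⟨fun k x => ∑ i, h i x * R i k, fun k => ?_, fun x hx => ?_⟩
    · exact Finset.analyticOnNhd_fun_sum _ fun i _ => (hh i).mul analyticOnNhd_const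
    · rw [hv x hx]
      simp only [← hR, lin_sum, lin_smul, Finset.smul_sum, Finset.sum_smul, smul_smul]
      exact Finset.sum_comm
  · have hexp : ∀ g : κ → (Fin n → ℂ) → ℂ, ∀ y, ∑ k, g k y • lin (e k) y =
        ∑ i, (∑ k, g k y * Q k i) • lin (b i) y := by
      intro g y
      simp only [← hQ, lin_sum, lin_smul, Finset.smul_sum, Finset.sum_smul, smul_smul]
      exact Finset.sum_comm
    have han : ∀ g : κ → (Fin n → ℂ) → ℂ, (∀ k, AnalyticOnNhd ℂ (g k) Set.univ) → ∀ i,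
        AnalyticOnNhd ℂ (fun y => ∑ k, g k y * Q k i) Set.univ := fun g hg i =>
      Finset.analyticOnNhd_fun_sum _ fun k _ => (hg k).mul analyticOnNhd_const
    have h1 := hb.2.2 _ _ (han h hh) (han h' hh') (fun y hy => by
      rw [← hexp, ← hexp, heq y hy])
    have h2 : ∑ k, (h k x - h' k x) • e k = 0 := by
      simp only [← hQ, Finset.smul_sum, smul_smul]
      rw [Finset.sum_comm]
      refine Finset.sum_eq_zero fun i _ => ?_
      rw [← Finset.sum_smul]
      simp only [sub_mul, Finset.sum_sub_distrib]
      rw [h1 i x hx, sub_self, zero_smul]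
    exact sub_eq_zero.mp (Fintype.linearIndependent_iff.mp he _ h2 k)

/-! ### Comparison of the zeros of f and Δ. -/

/-- Along the flow of A the polynomial p is multiplied by exp(ct), so the flow preserves its zeros.
Then f vanishes along the orbit of each of its zeros, and so does its derivative. Multiplicities of
p play no role. -/
theorem mem_tangentMatrices_of_linDer_eq_smul {p : MvPolynomial (Fin n) ℂ}
    (hf : AnalyticOnNhd ℂ f Set.univ)
    (hp : ∀ x, f x = 0 ↔ eval x p = 0) {A : Matrix (Fin n) (Fin n) ℂ} {c : ℂ}
    (h : linDer A p = c • p) : A ∈ tangentMatrices f := by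
  intro x hx
  let γ : ℂ → (Fin n → ℂ) := fun t => NormedSpace.exp (t • linCLM A) x
  have hγ0 : γ 0 = x := by
    have h0 : (0 : ℂ) • linCLM A = 0 := by ext; simp
    change NormedSpace.exp ((0 : ℂ) • linCLM A) x = x
    rw [h0, NormedSpace.exp_zero]
    rfl
  have hγ : ∀ t, HasDerivAt γ (lin A (γ t)) t := by
    intro t
    have := (hasDerivAt_exp_smul_const' (linCLM A) t).clm_apply (hasDerivAt_const t x)
    simpa [γ, linCLM_apply] using this
  have hu : ∀ t, HasDerivAt (fun t => eval (γ t) p) (c * eval (γ t) p) t := by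
    intro t
    obtain ⟨p', hp1, hp2⟩ := hasFDerivAt_eval p (γ t)
    have := hp1.comp_hasDerivAt t (hγ t)
    rw [hp2, h] at this
    simpa [smul_eval] using! this
  have hconst : ∀ t, Complex.exp (-(c * t)) * eval (γ t) p = eval x p := by
    have hd : ∀ t, HasDerivAt (fun t => Complex.exp (-(c * t)) * eval (γ t) p) 0 t := by
      intro t
      have h1 : HasDerivAt (fun t : ℂ => -(c * t)) (-c) t := by
        simpa using! ((hasDerivAt_id t).const_mul c).neg
      convert! h1.cexp.mul (hu t) using 1
      ring
    intro t
    have := is_const_of_deriv_eq_zero (fun t => (hd t).differentiableAt) (fun t => (hd t).deriv) t 0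
    simpa [hγ0] using this
  have hzero : ∀ t, f (γ t) = 0 := by
    intro t
    rw [hp]
    have := hconst t
    rw [(hp x).mp hx] at this
    exact (mul_eq_zero.mp this).resolve_left (Complex.exp_ne_zero _)
  have h1 := ((hf x (Set.mem_univ x)).differentiableAt.hasFDerivAt)
  rw [← hγ0] at h1
  have h2 := h1.comp_hasDerivAt 0 (hγ 0)
  have h3 : f ∘ γ = fun _ => 0 := funext hzero
  rw [h3, hγ0] at h2
  exact h2.unique (hasDerivAt_const 0 (0 : ℂ))

/-- A solution of `a u' = b u` with `a 0 ≠ 0` and `u 0 = 0` vanishes. -/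
theorem eq_zero_of_mul_deriv_eq {u a b : ℂ → ℂ} (hu : AnalyticOnNhd ℂ u Set.univ)
    (ha : AnalyticAt ℂ a 0) (hb : AnalyticAt ℂ b 0) (ha0 : a 0 ≠ 0) (hu0 : u 0 = 0)
    (h : ∀ t, a t * deriv u t = b t * u t) : u = 0 := by
  have hu' := hu 0 (Set.mem_univ _)
  -- If u had finite order m + 1 at 0, then a u' would have order m there and b u order at least m +
  -- 1.
  have hord : analyticOrderAt u 0 = ⊤ := by
    by_contra hne
    have h1 : analyticOrderAt (deriv u) 0 + 1 = analyticOrderAt u 0 := by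
      simpa [hu0] using hu'.analyticOrderAt_deriv_add_one
    have h2 : analyticOrderAt (a * deriv u) 0 = analyticOrderAt (b * u) 0 :=
      congrArg (analyticOrderAt · 0) (funext h)
    rw [analyticOrderAt_mul ha hu'.deriv, analyticOrderAt_mul hb hu',
      ha.analyticOrderAt_eq_zero.mpr ha0, zero_add, ← h1] at h2
    lift analyticOrderAt (deriv u) 0 to ℕ using (fun ht => hne (by rw [← h1, ht]; rfl)) with m
    have h3 : (m : ℕ∞) + 1 ≤ m := by
      conv_rhs => rw [h2]
      exact le_add_self
    exact absurd h3 (by exact_mod_cast Nat.not_succ_le_self m)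
  exact AnalyticOnNhd.eq_of_eventuallyEq hu (fun _ _ => analyticAt_const)
    (analyticOrderAt_eq_top.mp hord)

theorem discr_eq_det (δ : Fin n → Matrix (Fin n) (Fin n) ℂ) (x : Fin n → ℂ) :
    discr δ x = (Matrix.of fun i => lin (δ i) x).det := rfl

/-- For every constant vector e the field f e is logarithmic, so where f is non-zero the vectors
δᵢ(x) span ℂⁿ. -/
theorem discr_ne_zero_of_ne_zero (hf : AnalyticOnNhd ℂ f Set.univ)
    {δ : Fin n → Matrix (Fin n) (Fin n) ℂ} (hδ : IsLogBasis f Set.univ fun i => lin (δ i))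
    {x : Fin n → ℂ} (hx : f x ≠ 0) : discr δ x ≠ 0 := by
  have hlog : ∀ e : Fin n → ℂ, IsLogarithmic f Set.univ fun y => f y • e := fun e =>
    ⟨fun y hy => (hf y hy).smul analyticAt_const, fun y => fderiv ℂ f y e,
      fun y hy => ((ContinuousLinearMap.apply ℂ ℂ e).analyticAt _).comp (hf.fderiv y hy),
      fun y _ => by simp [act, mul_comm]⟩
  choose h _ hv using fun e => hδ.2.1 _ (hlog e)
  rw [discr_eq_det, ← isUnit_iff_ne_zero, ← Matrix.isUnit_iff_isUnit_det,
    ← Matrix.vecMul_surjective_iff_isUnit]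
  intro e
  refine ⟨fun i => (f x)⁻¹ * h e i x, ?_⟩
  have := hv e x (Set.mem_univ x)
  change Matrix.vecMul _ _ = e
  rw [Matrix.vecMul_eq_sum]
  simp only [mul_smul, ← Finset.smul_sum]
  change (f x)⁻¹ • ∑ i, h e i x • lin (δ i) x = e
  rw [← this, inv_smul_smul₀ hx]

/-- If the δᵢ spanned at a zero x of f, then f restricted to any line through x would solve a linear
differential equation, regular at x, with zero initial value. It would vanish on all these lines,
hence everywhere. -/
theorem discr_eq_zero_of_eq_zero (hf : IsReducedEquation f)
    {δ : Fin n → Matrix (Fin n) (Fin n) ℂ} (hδ : IsLogBasis f Set.univ fun i => lin (δ i))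
    {x : Fin n → ℂ} (hx : f x = 0) : discr δ x = 0 := by
  by_contra hne
  obtain ⟨y, hy⟩ := hf.ne_zero
  let l : ℂ → (Fin n → ℂ) := fun t => x + t • (y - x)
  have hl : AnalyticOnNhd ℂ l Set.univ := fun t _ =>
    analyticAt_const.add (analyticAt_id.smul analyticAt_const)
  have hlA : ∀ g : (Fin n → ℂ) → ℂ, AnalyticOnNhd ℂ g Set.univ →
      AnalyticOnNhd ℂ (fun t => g (l t)) Set.univ := fun g hg t _ =>
    (hg (l t) (Set.mem_univ _)).comp (hl t (Set.mem_univ _))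
  have hld : ∀ t, HasDerivAt l (y - x) t := fun t => by
    have := ((hasDerivAt_id t).smul_const (y - x)).const_add x
    rwa [one_smul] at this
  choose _ g hg hgf using hδ.1
  let M : ℂ → Matrix (Fin n) (Fin n) ℂ := fun t => Matrix.of fun i => lin (δ i) (l t)
  let Mp : Matrix (Fin n) (Fin n) (MvPolynomial (Fin n) ℂ) :=
    Matrix.of fun i j => linDer (δ i) (X j)
  have hM : ∀ t, M t = (eval (l t)).mapMatrix Mp := by
    intro t
    refine Matrix.ext fun i j => ?_
    simp only [M, Mp, RingHom.mapMatrix_apply, Matrix.map_apply, Matrix.of_apply, eval_linDer_X]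
  have hpoly : ∀ p : MvPolynomial (Fin n) ℂ, AnalyticOnNhd ℂ (fun z => eval z p) Set.univ :=
    fun p => AnalyticOnNhd.eval_mvPolynomial p
  -- By Cramer's rule these are the coefficients of Δ · (y - x) in terms of the δᵢ along the line,
  -- holomorphic without any division.
  let c : ℂ → Fin n → ℂ := fun t => Matrix.vecMul (y - x) (M t).adjugate
  have hc : ∀ i, AnalyticOnNhd ℂ (fun t => c t i) Set.univ := by
    intro i
    have : (fun t => c t i) = fun t => ∑ j, (y - x) j * eval (l t) (Mp.adjugate j i) := by
      funext t
      simp only [c, Matrix.vecMul, dotProduct, hM, ← RingHom.map_adjugate]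
      rfl
    rw [this]
    exact Finset.analyticOnNhd_fun_sum _ fun j _ => analyticOnNhd_const.mul (hlA _ (hpoly _))
  have hcM : ∀ t, (M t).det • (y - x) = ∑ i, c t i • lin (δ i) (l t) := by
    intro t
    have : Matrix.vecMul (c t) (M t) = (M t).det • (y - x) := by
      simp only [c, Matrix.vecMul_vecMul, Matrix.adjugate_mul, Matrix.vecMul_smul,
        Matrix.vecMul_one]
    rw [← this, Matrix.vecMul_eq_sum]
    rfl
  have hdet : AnalyticOnNhd ℂ (fun t => (M t).det) Set.univ := by
    have : (fun t => (M t).det) = fun t => eval (l t) Mp.det := by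
      funext t
      rw [hM, RingHom.map_det]
    rw [this]
    exact hlA _ (hpoly _)
  have hu := hlA f hf.holomorphic
  have hud : ∀ t, deriv (fun t => f (l t)) t = fderiv ℂ f (l t) (y - x) := fun t =>
    ((hf.holomorphic (l t) (Set.mem_univ _)).differentiableAt.hasFDerivAt.comp_hasDerivAt t
      (hld t)).deriv
  have hl0 : l 0 = x := by simp [l]
  have hzero := eq_zero_of_mul_deriv_eq (b := fun t => ∑ i, c t i * g i (l t)) hu
    (hdet 0 (Set.mem_univ _))
    (Finset.analyticAt_fun_sum _ fun i _ =>
      (hc i 0 (Set.mem_univ _)).mul (hlA _ (hg i) 0 (Set.mem_univ _)))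
    (by rw [discr_eq_det, ← hl0] at hne; exact hne) (by rw [hl0, hx]) (fun t => by
      rw [hud, ← smul_eq_mul, ← map_smul, hcM, map_sum, Finset.sum_mul]
      refine Finset.sum_congr rfl fun i _ => ?_
      have : fderiv ℂ f (l t) (lin (δ i) (l t)) = g i (l t) * f (l t) :=
        hgf i (l t) (Set.mem_univ _)
      rw [map_smul, this, smul_eq_mul, mul_assoc])
  refine hy ?_
  have := congrFun hzero 1
  simpa [l] using this

theorem eq_zero_iff_discr_eq_zero (hf : IsReducedEquation f)
    {δ : Fin n → Matrix (Fin n) (Fin n) ℂ} (hδ : IsLogBasis f Set.univ fun i => lin (δ i))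
    (x : Fin n → ℂ) : f x = 0 ↔ discr δ x = 0 :=
  ⟨discr_eq_zero_of_eq_zero hf hδ,
    fun h => by_contra fun h' => discr_ne_zero_of_ne_zero hf.holomorphic hδ h' h⟩

/-! ### An obstruction from reducedness. -/

/-- A degree `0` basis of the logarithmic vector fields along a reduced divisor cannot consist of
the Euler field and of fields that are strictly triangular with respect to two coordinates. -/
theorem not_isLogBasis_of_triangular (hf : IsReducedEquation f) {m : ℕ}
    {ν : Fin m → Matrix (Fin n) (Fin n) ℂ} {y₁ y₂ : Fin n → ℂ}
    (hy : LinearIndependent ℂ ![y₁, y₂]) (h1 : ∀ j, ν j *ᵥ y₁ = 0)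
    (h2 : ∀ j, ∃ c : ℂ, ν j *ᵥ y₂ = c • y₁) :
    ¬ IsLogBasis f Set.univ
      (Sum.elim (fun _ : Unit => lin (1 : Matrix (Fin n) (Fin n) ℂ)) fun j => lin (ν j)) := by
  intro hb
  choose c hc using h2
  have hdual : ∀ a b : ℂ, ∃ e : Fin n → ℂ, e ⬝ᵥ y₁ = a ∧ e ⬝ᵥ y₂ = b := by
    intro a b
    obtain ⟨φ, hφ⟩ := LinearMap.exists_extend
      ((Finsupp.linearCombination ℂ ![a, b]).comp hy.repr)
    have hφi : ∀ i, φ (![y₁, y₂] i) = ![a, b] i := by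
      intro i
      let z : Submodule.span ℂ (Set.range ![y₁, y₂]) :=
        ⟨![y₁, y₂] i, Submodule.subset_span ⟨i, rfl⟩⟩
      have h3 : φ (![y₁, y₂] i) = Finsupp.linearCombination ℂ ![a, b] (hy.repr z) :=
        LinearMap.congr_fun hφ z
      rw [h3, hy.repr_eq_single i z rfl]
      simp
    have hdot : ∀ y, (fun i => φ (Pi.single i 1)) ⬝ᵥ y = φ y := by
      intro y
      conv_rhs => rw [pi_eq_sum_univ' y]
      simp [dotProduct, mul_comm]
    exact ⟨_, (hdot y₁).trans (hφi 0), (hdot y₂).trans (hφi 1)⟩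
  obtain ⟨e, he1, he2⟩ := hdual 1 0
  obtain ⟨e', he1', he2'⟩ := hdual 0 1
  have hfa := hf.holomorphic
  -- Let ℓᵢ(x) = x ⬝ᵥ yᵢ. Pairing the expansion of f e with y₁ gives f = k ℓ₁; pairing it with y₂
  -- shows that ℓ₁ divides k ℓ₂.
  obtain ⟨h, hh, hv⟩ := hb.2.1 (fun y => f y • e)
    ⟨fun y hy => (hfa y hy).smul analyticAt_const, fun y => fderiv ℂ f y e,
      fun y hy => ((ContinuousLinearMap.apply ℂ ℂ e).analyticAt _).comp (hfa.fderiv y hy),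
      fun y _ => by simp [act, mul_comm]⟩
  have hdot : ∀ (y x : Fin n → ℂ), f x * (e ⬝ᵥ y) = h (Sum.inl ()) x * (x ⬝ᵥ y) +
      ∑ j, h (Sum.inr j) x * (x ⬝ᵥ (ν j *ᵥ y)) := by
    intro y x
    have := congrArg (· ⬝ᵥ y) (hv x (Set.mem_univ x))
    simpa [Fintype.sum_sum_type, add_dotProduct, sum_dotProduct, smul_dotProduct, lin_one, lin,
      Matrix.dotProduct_mulVec] using this
  set k := h (Sum.inl ()) with hk
  have hka : AnalyticOnNhd ℂ k Set.univ := hh _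
  have hf1 : ∀ x, f x = k x * (x ⬝ᵥ y₁) := by
    intro x
    simpa [he1, h1] using hdot y₁ x
  have hf2 : ∀ x, k x * (x ⬝ᵥ y₂) = -(∑ j, h (Sum.inr j) x * c j) * (x ⬝ᵥ y₁) := by
    intro x
    have := hdot y₂ x
    simp only [he2, hc, dotProduct_smul, smul_eq_mul, mul_zero] at this
    rw [neg_mul, Finset.sum_mul]
    simp only [mul_assoc]
    linear_combination -this
  -- On ℓ₁ = 0 the product k ℓ₂ vanishes, so k does where ℓ₂ ≠ 0. The remaining points are limits of
  -- such points in the direction e', along which ℓ₁ is constant.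
  have hk1 : ∀ x, x ⬝ᵥ y₁ = 0 → k x = 0 := by
    intro x hx
    by_cases hx2 : x ⬝ᵥ y₂ = 0
    · have hkc : Continuous k := continuousOn_univ.mp hka.continuousOn
      have hcont : Continuous fun t : ℂ => k (x + t • e') := by fun_prop
      have h3 : ∀ t : ℂ, t ≠ 0 → k (x + t • e') = 0 := by
        intro t ht
        have := hf2 (x + t • e')
        simp only [add_dotProduct, smul_dotProduct, hx, hx2, he1', he2', smul_eq_mul, mul_zero,
          mul_one, zero_add] at this
        exact (mul_eq_zero.mp this).resolve_right ht
      have h4 : Tendsto (fun t : ℂ => k (x + t • e')) (𝓝[≠] 0) (𝓝 0) :=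
        tendsto_const_nhds.congr' (eventually_nhdsWithin_of_forall fun t ht => (h3 t ht).symm)
      have h5 := tendsto_nhds_unique h4 ((hcont.tendsto 0).mono_left nhdsWithin_le_nhds)
      simpa using h5.symm
    · have := hf2 x
      rw [hx, mul_zero] at this
      exact (mul_eq_zero.mp this).resolve_right hx2
  -- Every zero of f = k ℓ₁ is a zero of k, so k = q f = q k ℓ₁. Near the origin 1 - q ℓ₁ is
  -- non-zero, which forces k = 0 and f = 0.
  obtain ⟨q, hq, hkq⟩ := hf.reduced Set.univ k isOpen_univ hka fun x _ hx => by
    rw [hf1] at hx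
    exact (mul_eq_zero.mp hx).elim id (hk1 x)
  have hqc : Continuous q := continuousOn_univ.mp hq.continuousOn
  have hev : ∀ᶠ x in 𝓝 (0 : Fin n → ℂ), 1 - q x * (x ⬝ᵥ y₁) ≠ 0 := by
    have hcont : Continuous fun x : Fin n → ℂ => 1 - q x * (x ⬝ᵥ y₁) := by
      unfold dotProduct
      fun_prop
    exact hcont.continuousAt.eventually_ne (by simp)
  have hf0 : f =ᶠ[𝓝 0] 0 := by
    filter_upwards [hev] with x hx
    have h3 := hkq x (Set.mem_univ x)
    rw [hf1] at h3
    have h4 : k x * (1 - q x * (x ⬝ᵥ y₁)) = 0 := by linear_combination h3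
    rw [hf1, (mul_eq_zero.mp h4).resolve_right hx, zero_mul]
    rfl
  obtain ⟨x, hx⟩ := hf.ne_zero
  exact hx (congrFun (AnalyticOnNhd.eq_of_eventuallyEq hfa (fun _ _ => analyticAt_const) hf0) x)

/-! ### The maximal torus and the root vectors. -/

variable {δ : Fin n → Matrix (Fin n) (Fin n) ℂ}

theorem discrPoly_ne_zero (hf : IsReducedEquation f)
    (hδ : IsLogBasis f Set.univ fun i => lin (δ i)) : discrPoly δ ≠ 0 := by
  intro h
  obtain ⟨x, hx⟩ := hf.ne_zero
  exact discr_ne_zero_of_ne_zero hf.holomorphic hδ hx (by rw [← eval_discrPoly, h, map_zero])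

theorem linDer_one_discrPoly (δ : Fin n → Matrix (Fin n) (Fin n) ℂ) :
    linDer 1 (discrPoly δ) = (n : ℂ) • discrPoly δ := by
  have := linDer_discrPoly (δ := δ) (A := 1) (C := 0) (fun i => by simp [Ring.lie_def])
  simpa using this

theorem mem_tangentMatrices_iff (hf : IsReducedEquation f)
    (hδ : IsLogBasis f Set.univ fun i => lin (δ i)) (A : Matrix (Fin n) (Fin n) ℂ) :
    A ∈ tangentMatrices f ↔ ∃ c : ℂ, linDer A (discrPoly δ) = c • discrPoly δ := by
  constructor
  · intro hA
    have hspan := span_eq_of_isLogBasis hf hδ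
    have : ∀ i, ∃ c : Fin n → ℂ, ∑ k, c k • δ k = ⁅A, δ i⁆ := fun i => by
      rw [← Submodule.mem_span_range_iff_exists_fun, hspan]
      exact lie_mem_tangentMatrices hf hA (hspan ▸ Submodule.subset_span ⟨i, rfl⟩)
    choose C hC using this
    exact ⟨_, linDer_discrPoly (C := Matrix.of C) fun i => (hC i).symm⟩
  · rintro ⟨c, hc⟩
    exact mem_tangentMatrices_of_linDer_eq_smul hf.holomorphic
      (fun x => by rw [eq_zero_iff_discr_eq_zero hf hδ, eval_discrPoly]) hc

theorem one_mem_tangentMatrices (hf : IsReducedEquation f)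
    (hδ : IsLogBasis f Set.univ fun i => lin (δ i)) : 1 ∈ tangentMatrices f :=
  (mem_tangentMatrices_iff hf hδ 1).mpr ⟨n, linDer_one_discrPoly δ⟩

/-- Together with `mem_tangentMatrices_iff` this puts both Jordan parts of a logarithmic field among
the logarithmic fields. -/
theorem IsJordanDecomposition.linDer_eq {A S N : Matrix (Fin n) (Fin n) ℂ}
    (h : IsJordanDecomposition A S N) {c : ℂ} {p : MvPolynomial (Fin n) ℂ}
    (hA : linDer A p = c • p) : linDer S p = c • p ∧ linDer N p = 0 := by
  obtain ⟨P, hP, d, hd⟩ := exists_simultaneous_diagonalization (fun _ : Unit => S)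
    (fun _ => h.semisimple) (fun _ _ => Commute.refl S)
  exact linDer_eq_of_diagonalizable_add_nilpotent hP (hd ()) h.nilpotent h.commute (h.eq_add ▸ hA)

theorem discrPoly_eq_of_eq_sum {b : Fin n → Matrix (Fin n) (Fin n) ℂ}
    {R : Matrix (Fin n) (Fin n) ℂ} (h : ∀ i, b i = ∑ k, R i k • δ k) :
    discrPoly b = R.det • discrPoly δ := by
  have : (Matrix.of fun i j => linDer (b i) (X j : MvPolynomial (Fin n) ℂ)) =
      R.map MvPolynomial.C * Matrix.of fun i j => linDer (δ i) (X j) := by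
    refine Matrix.ext fun i j => ?_
    simp only [Matrix.of_apply, Matrix.mul_apply, Matrix.map_apply, h, linDer_X, Matrix.sum_apply,
      Matrix.smul_apply, smul_eq_mul, Finset.sum_smul, smul_eq_C_mul, Finset.mul_sum, map_mul,
      mul_assoc]
    exact Finset.sum_comm
  rw [discrPoly, this, Matrix.det_mul, smul_eq_C_mul, RingHom.map_det]
  rfl

theorem mem_diagonalRanks (hf : IsReducedEquation f) {r : ℕ} {P : Matrix (Fin n) (Fin n) ℂ}
    (hP : IsUnit P.det) {d : Fin r → Fin n → ℂ} (hd : LinearIndependent ℂ d)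
    (h : ∀ k, conjDiag P (d k) ∈ tangentMatrices f) : r ∈ diagonalRanks f :=
  ⟨P, hP, d, hd, fun k => (isLogarithmic_lin_iff hf _).mpr (h k)⟩

/-- A maximal torus of the Lie algebra of logarithmic vector fields of degree `0` is spanned by
the Euler field and by diagonalizable fields with rational eigenvalues annihilating `Δ`. -/
theorem exists_rational_torus (hn : 1 ≤ n) (hf : IsReducedEquation f)
    (hδ : IsLogBasis f Set.univ fun i => lin (δ i)) :
    ∃ s : ℕ, IsGreatest (diagonalRanks f) (s + 1) ∧
      ∃ P : Matrix (Fin n) (Fin n) ℂ, IsUnit P.det ∧ ∃ w : Fin s → Fin n → ℚ,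
        LinearIndependent ℂ (Fin.cons 1 fun i k => (w i k : ℂ) : Fin (s + 1) → Fin n → ℂ) ∧
        ∀ i, linDer (conjDiag P fun k => (w i k : ℂ)) (discrPoly δ) = 0 := by
  have h1 : 1 ∈ diagonalRanks f :=
    mem_diagonalRanks hf (P := 1) (d := fun _ => 1) (by simp) (by
      have : Nonempty (Fin n) := ⟨⟨0, hn⟩⟩
      exact LinearIndependent.of_subsingleton 0 one_ne_zero)
      (fun _ => by rw [conjDiag_one (by simp)]; exact one_mem_tangentMatrices hf hδ)
  have hbdd : BddAbove (diagonalRanks f) := by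
    refine ⟨n, ?_⟩
    rintro r ⟨P, -, d, hd, -⟩
    simpa using hd.fintype_card_le_finrank
  have hgreat : IsGreatest (diagonalRanks f) (sSup (diagonalRanks f)) :=
    ⟨Nat.sSup_mem ⟨1, h1⟩ hbdd, fun r hr => le_csSup hbdd hr⟩
  obtain ⟨s, hs⟩ : ∃ s, sSup (diagonalRanks f) = s + 1 :=
    Nat.exists_eq_add_of_le' (le_csSup hbdd h1)
  rw [hs] at hgreat
  refine ⟨s, hgreat, ?_⟩
  obtain ⟨P, hP, d, hd, hdlog⟩ := hgreat.1
  obtain ⟨g, hg⟩ : ∃ g, discrPoly δ = subst P g :=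
    ⟨subst P⁻¹ (discrPoly δ), by rw [subst_subst, Matrix.mul_nonsing_inv _ hP, subst_one]⟩
  have hinj : Function.Injective (subst P) := by
    intro a b hab
    have := congrArg (subst P⁻¹) hab
    simpa [subst_subst, Matrix.nonsing_inv_mul _ hP, subst_one] using this
  have hconj : ∀ e, conjDiag P e * P = P * diagonal e := fun e => by
    rw [conjDiag_apply, Matrix.mul_assoc, Matrix.nonsing_inv_mul _ hP, Matrix.mul_one]
  -- Monomials are weight vectors of a diagonal field, so g is an eigenvector exactly when all its
  -- monomials have the same weight.
  have heig : ∀ (e : Fin n → ℂ) (c : ℂ), linDer (conjDiag P e) (discrPoly δ) = c • discrPoly δ ↔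
      ∀ α : g.support, ∑ k, (α.1 k : ℂ) * e k = c := by
    intro e c
    rw [hg, linDer_subst (hconj e), ← map_smul, hinj.eq_iff]
    constructor
    · intro h α
      have := congrArg (coeff α.1) h
      rw [coeff_linDer_diagonal, coeff_smul, smul_eq_mul] at this
      exact mul_right_cancel₀ (mem_support_iff.mp α.2) this
    · intro h
      ext α
      rw [coeff_linDer_diagonal, coeff_smul, smul_eq_mul]
      by_cases hα : α ∈ g.support
      · rw [h ⟨α, hα⟩]
      · rw [notMem_support_iff.mp hα, mul_zero, mul_zero]
  have hdeg : ∀ α : g.support, ∑ k, (α.1 k : ℂ) = n := by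
    have := (heig 1 n).mp (by rw [conjDiag_one hP]; exact linDer_one_discrPoly δ)
    simpa using this
  have hn0 : (n : ℂ) ≠ 0 := by exact_mod_cast (by omega : n ≠ 0)
  obtain ⟨r, w, hw, hwspan⟩ := exists_rational_basis fun (α : g.support) k => (α.1 k : ℚ)
  have hwspan' : ∀ e : Fin n → ℂ,
      e ∈ Submodule.span ℂ (Set.range fun i k => (w i k : ℂ)) ↔
        linDer (conjDiag P e) (discrPoly δ) = 0 := by
    intro e
    rw [hwspan, ← zero_smul ℂ (discrPoly δ), heig]
    simp
  have hker : ∀ i, linDer (conjDiag P fun k => (w i k : ℂ)) (discrPoly δ) = 0 := fun i =>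
    (hwspan' _).mp (Submodule.subset_span ⟨i, rfl⟩)
  have hwlin : LinearIndependent ℂ
      (Fin.cons 1 fun i k => (w i k : ℂ) : Fin (r + 1) → Fin n → ℂ) := by
    refine LinearIndependent.finCons hw fun h => ?_
    rw [hwspan', conjDiag_one hP, linDer_one_discrPoly] at h
    exact (smul_ne_zero hn0 (discrPoly_ne_zero hf hδ)) h
  have hrs : r = s := by
    apply le_antisymm
    · have : r + 1 ∈ diagonalRanks f := mem_diagonalRanks hf hP hwlin fun k => by
        refine Fin.cases ?_ (fun i => ?_) k
        · simpa [conjDiag_one hP] using one_mem_tangentMatrices hf hδ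
        · exact (mem_tangentMatrices_iff hf hδ _).mpr ⟨0, by simpa using hker i⟩
      simpa using hgreat.2 this
    -- Since Δ is homogeneous of degree n, subtracting (c / n) χ from a diagonal field with
    -- eigenvalue c on Δ yields one that kills Δ.
    · have hle : Submodule.span ℂ (Set.range d) ≤ Submodule.span ℂ
          (Set.range (Fin.cons 1 fun i k => (w i k : ℂ) : Fin (r + 1) → Fin n → ℂ)) := by
        rw [Submodule.span_le]
        rintro _ ⟨k, rfl⟩
        obtain ⟨c, hc⟩ := (mem_tangentMatrices_iff hf hδ _).mp
          ((isLogarithmic_lin_iff hf _).mp (hdlog k))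
        have hc' := (heig (d k) c).mp hc
        have hmem : d k - (c / n) • (1 : Fin n → ℂ) ∈
            Submodule.span ℂ (Set.range fun i k => (w i k : ℂ)) := by
          rw [hwspan]
          intro α
          have h1 := hc' α
          have h2 := hdeg α
          simp only [Pi.sub_apply, Pi.smul_apply, Pi.one_apply, smul_eq_mul, mul_one, mul_sub,
            Finset.sum_sub_distrib, ← Finset.sum_mul]
          push_cast
          rw [h1, h2]
          field_simp
          ring
        rw [Fin.range_cons, ← sub_add_cancel (d k) ((c / n) • (1 : Fin n → ℂ))]
        refine Submodule.add_mem _ (Submodule.span_mono (Set.subset_insert _ _) hmem)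
          (Submodule.smul_mem _ _ (Submodule.subset_span (Set.mem_insert _ _)))
      have h1 := Submodule.finrank_mono hle
      rw [finrank_span_eq_card hd, finrank_span_eq_card hwlin] at h1
      simpa using h1
  subst hrs
  exact ⟨P, hP, w, hwlin, hker⟩

/-- Elements of the centralizer of a maximal torus have their semisimple part in the torus. -/
theorem mem_span_of_commute_torus (hf : IsReducedEquation f) {s : ℕ}
    (hs : ∀ r ∈ diagonalRanks f, r ≤ s + 1) {P : Matrix (Fin n) (Fin n) ℂ} (hP : IsUnit P.det)
    {w : Fin (s + 1) → Fin n → ℂ} (hw : LinearIndependent ℂ w)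
    (hwL : ∀ i, conjDiag P (w i) ∈ tangentMatrices f) {S : Matrix (Fin n) (Fin n) ℂ}
    (hSL : S ∈ tangentMatrices f) (hSs : Module.End.IsSemisimple (Matrix.toLin' S))
    (hc : ∀ i, Commute (conjDiag P (w i)) S) :
    S ∈ Submodule.span ℂ (Set.range fun i => conjDiag P (w i)) := by
  by_contra hS
  -- Outside the span, S would enlarge the torus to s + 2 independent fields, simultaneously
  -- diagonalizable, against maximality.
  let F : Fin (s + 1 + 1) → Matrix (Fin n) (Fin n) ℂ := Fin.cons S fun i => conjDiag P (w i)
  have hF : LinearIndependent ℂ F := LinearIndependent.finCons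
    (hw.map' (conjDiag P) (LinearMap.ker_eq_bot.mpr (conjDiag_injective hP))) hS
  obtain ⟨Q, hQ, d, hd⟩ := exists_simultaneous_diagonalization F
    (fun i => Fin.cases hSs (fun i => isSemisimple_conjDiag hP (w i)) i)
    (fun i j => by
      refine Fin.cases ?_ (fun i => ?_) i <;> refine Fin.cases ?_ (fun j => ?_) j
      · exact Commute.refl _
      · exact (hc j).symm
      · exact hc i
      · exact commute_conjDiag hP _ _)
  have hdlin : LinearIndependent ℂ d := by
    have : F = conjDiag Q ∘ d := funext hd
    rw [this] at hF
    exact hF.of_comp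
  have := hs _ (mem_diagonalRanks hf hQ hdlin fun i => by
    rw [← hd]
    exact Fin.cases hSL hwL i)
  omega

theorem commute_of_lie_eq_zero {A B : Matrix (Fin n) (Fin n) ℂ} (h : ⁅A, B⁆ = 0) :
    Commute A B := sub_eq_zero.mp (by rw [← h, Ring.lie_def])

theorem lie_eq_zero_of_commute {A B : Matrix (Fin n) (Fin n) ℂ} (h : Commute A B) :
    ⁅A, B⁆ = 0 := by rw [Ring.lie_def, h.eq, sub_self]

theorem IsJordanDecomposition.mem_span_torus (hn : 1 ≤ n) (hf : IsReducedEquation f)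
    (hδ : IsLogBasis f Set.univ fun i => lin (δ i)) {s : ℕ}
    (hs : ∀ r ∈ diagonalRanks f, r ≤ s + 1) {P : Matrix (Fin n) (Fin n) ℂ} (hP : IsUnit P.det)
    {w : Fin s → Fin n → ℂ}
    (hw : LinearIndependent ℂ (Fin.cons 1 w : Fin (s + 1) → Fin n → ℂ))
    (hker : ∀ i, linDer (conjDiag P (w i)) (discrPoly δ) = 0) {A S N : Matrix (Fin n) (Fin n) ℂ}
    (h : IsJordanDecomposition A S N) (hA : A ∈ tangentMatrices f)
    (hc : ∀ i, ⁅conjDiag P (w i), A⁆ = 0) :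
    S ∈ Submodule.span ℂ (insert 1 (Set.range fun i => conjDiag P (w i))) ∧
      (linDer A (discrPoly δ) = 0 →
        S ∈ Submodule.span ℂ (Set.range fun i => conjDiag P (w i))) := by
  have hcons : (fun i => conjDiag P ((Fin.cons 1 w : Fin (s + 1) → Fin n → ℂ) i)) =
      Fin.cons 1 fun i => conjDiag P (w i) := by
    funext i
    exact Fin.cases (by simp [conjDiag_one hP]) (fun i => by simp) i
  have hS : S ∈ Submodule.span ℂ (insert 1 (Set.range fun i => conjDiag P (w i))) := by
    rw [← Fin.range_cons, ← hcons]
    obtain ⟨c, hcA⟩ := (mem_tangentMatrices_iff hf hδ A).mp hA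
    refine mem_span_of_commute_torus hf hs hP hw (fun i => ?_)
      ((mem_tangentMatrices_iff hf hδ S).mpr ⟨c, (h.linDer_eq hcA).1⟩) h.semisimple fun i => ?_
    · refine Fin.cases ?_ (fun i => ?_) i
      · simpa [conjDiag_one hP] using one_mem_tangentMatrices hf hδ
      · exact (mem_tangentMatrices_iff hf hδ _).mpr ⟨0, by simpa using hker i⟩
    · refine Fin.cases ?_ (fun i => ?_) i
      · simp [conjDiag_one hP]
      · exact h.commute_left (commute_of_lie_eq_zero (hc i))
  refine ⟨hS, fun hA0 => ?_⟩
  -- Write S = c χ + τ. Both S and τ kill Δ, while χ multiplies it by n, so c = 0.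
  obtain ⟨c, τ, hτ, rfl⟩ := Submodule.mem_span_insert.mp hS
  have hS0 : linDer (c • 1 + τ) (discrPoly δ) = 0 := by
    simpa using (h.linDer_eq (c := 0) (by simp [hA0])).1
  have hτ0 : linDer τ (discrPoly δ) = 0 := by
    clear h hS hS0
    induction hτ using Submodule.span_induction with
    | mem x hx => obtain ⟨i, rfl⟩ := hx; exact hker i
    | zero => rw [linDer_zero]; rfl
    | add x y _ _ hx hy => rw [linDer_add, Derivation.add_apply, hx, hy, add_zero]
    | smul a x _ hx => rw [linDer_smul, Derivation.smul_apply, hx, smul_zero]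
  rw [linDer_add, linDer_smul, Derivation.add_apply, Derivation.smul_apply, hτ0, add_zero,
    linDer_one_discrPoly, smul_smul] at hS0
  have hc0 := (smul_eq_zero.mp hS0).resolve_right (discrPoly_ne_zero hf hδ)
  have hn0 : (n : ℂ) ≠ 0 := by exact_mod_cast (by omega : n ≠ 0)
  rw [(mul_eq_zero.mp hc0).resolve_right hn0, zero_smul, zero_add]
  exact hτ

/-- The Lie algebra of logarithmic vector fields of degree `0` is spanned by the rational torus
and by nilpotent root vectors. -/
theorem tangentMatrices_le_span (hn : 1 ≤ n) (hf : IsReducedEquation f)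
    (hδ : IsLogBasis f Set.univ fun i => lin (δ i)) {s : ℕ}
    (hs : ∀ r ∈ diagonalRanks f, r ≤ s + 1) {P : Matrix (Fin n) (Fin n) ℂ} (hP : IsUnit P.det)
    {w : Fin s → Fin n → ℚ}
    (hw : LinearIndependent ℂ (Fin.cons 1 fun i k => (w i k : ℂ) : Fin (s + 1) → Fin n → ℂ))
    (hker : ∀ i, linDer (conjDiag P fun k => (w i k : ℂ)) (discrPoly δ) = 0) :
    tangentMatrices f ≤ Submodule.span ℂ
      (insert 1 (Set.range fun i => conjDiag P fun k => (w i k : ℂ)) ∪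
        {A | A ∈ tangentMatrices f ∧ IsNilpotent A ∧
          ∃ q : Fin s → ℚ, ∀ i, ⁅conjDiag P fun k => (w i k : ℂ), A⁆ = (q i : ℂ) • A}) := by
  have hσ : ∀ i, (conjDiag P fun k => (w i k : ℂ)) ∈ tangentMatrices f := fun i =>
    (mem_tangentMatrices_iff hf hδ _).mpr ⟨0, by simpa using hker i⟩
  refine (le_span_joint_eigenvectors (fun i => matAd (conjDiag P fun k => (w i k : ℂ)))
    (fun i => isSemisimple_matAd_conjDiag hP _)
    (fun i j => commute_matAd (commute_conjDiag hP _ _)) (tangentMatrices f)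
    (fun i v hv => lie_mem_tangentMatrices hf (hσ i) hv)).trans (Submodule.span_le.mpr ?_)
  rintro A ⟨hA, hμ⟩
  choose μ hμ using hμ
  simp only [matAd_apply] at hμ
  by_cases hA0 : A = 0
  · rw [hA0]; exact Submodule.zero_mem _
  -- At weight zero A commutes with the torus and is split into its Jordan parts; otherwise A is
  -- itself nilpotent and its weights are differences of rational eigenvalues.
  by_cases hz : ∀ i, μ i = 0
  · have hc : ∀ i, ⁅conjDiag P fun k => (w i k : ℂ), A⁆ = 0 := fun i => by
      rw [hμ, hz, zero_smul]
    obtain ⟨S, N, h⟩ := exists_isJordanDecomposition A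
    obtain ⟨c, hcA⟩ := (mem_tangentMatrices_iff hf hδ A).mp hA
    rw [h.eq_add]
    refine Submodule.add_mem _ (Submodule.span_mono Set.subset_union_left
      (h.mem_span_torus hn hf hδ hs hP hw hker hA hc).1)
      (Submodule.subset_span (Or.inr ⟨?_, h.nilpotent, fun _ => 0, fun i => ?_⟩))
    · exact (mem_tangentMatrices_iff hf hδ N).mpr ⟨0, by simpa using (h.linDer_eq hcA).2⟩
    · have hS := lie_eq_zero_of_commute (h.commute_left (commute_of_lie_eq_zero (hc i)))
      have hAi := hc i
      rw [h.eq_add, ← matAd_apply, map_add, matAd_apply, matAd_apply, hS, zero_add] at hAi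
      simpa using hAi
  · push Not at hz
    obtain ⟨i, hi⟩ := hz
    have hq : ∀ i, ∃ q : ℚ, (q : ℂ) = μ i := fun i => by
      obtain ⟨a, b, hab⟩ := exists_eq_sub_of_lie_eq_smul hP _ hA0 (hμ i)
      exact ⟨w i a - w i b, by push_cast; exact hab⟩
    choose q hq using hq
    exact Submodule.subset_span (Or.inr ⟨hA, isNilpotent_of_lie_eq_smul hP _ hi (hμ i), q,
      fun i => by rw [hq, hμ]⟩)

/-- Extension of a linearly independent family by elements of a set that complements it to a
spanning set. -/
theorem exists_extension_of_span {V : Type*} [AddCommGroup V] [Module ℂ V] [FiniteDimensional ℂ V]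
    {ι : Type*} {v : ι → V} (hv : LinearIndependent ℂ v) (T : Set V) :
    ∃ (m : ℕ) (ν : Fin m → V), (∀ j, ν j ∈ T) ∧ LinearIndependent ℂ (Sum.elim v ν) ∧
      Submodule.span ℂ (Set.range (Sum.elim v ν)) = Submodule.span ℂ (Set.range v ∪ T) := by
  obtain ⟨b, hbT, hvb, hspan, hb⟩ := exists_linearIndepOn_id_extension hv.linearIndepOn_id
    (Set.subset_union_left (s := Set.range v) (t := T))
  have hfin : b.Finite := hb.setFinite
  have : Fintype ↥(b \ Set.range v) := (hfin.subset Set.sdiff_subset).fintype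
  let e := (Fintype.equivFin ↥(b \ Set.range v)).symm
  have hrange : Set.range (Sum.elim v fun j => ((e j : ↥(b \ Set.range v)) : V)) = b := by
    rw [Set.Sum.elim_range]
    have : (Set.range fun j => ((e j : ↥(b \ Set.range v)) : V)) = b \ Set.range v := by
      rw [show (fun j => ((e j : ↥(b \ Set.range v)) : V)) = Subtype.val ∘ e from rfl,
        e.surjective.range_comp, Subtype.range_coe]
    rw [this, Set.union_sdiff_cancel hvb]
  refine ⟨_, fun j => (e j : V), fun j => ?_, ?_, ?_⟩
  · exact (hbT (e j).2.1).resolve_left (e j).2.2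
  · have hinj : Function.Injective (Sum.elim v fun j => ((e j : ↥(b \ Set.range v)) : V)) :=
      hv.injective.sumElim (Subtype.val_injective.comp e.injective)
        fun i j h => (e j).2.2 ⟨i, h⟩
    rw [← linearIndepOn_id_range_iff hinj, hrange]
    exact hb
  · rw [hrange]
    exact le_antisymm (Submodule.span_mono hbT) (Submodule.span_le.mpr hspan)

/-! ### Engel's theorem. -/

section Engel

attribute [local instance] LieRing.ofAssociativeRing

/-- A Lie algebra of nilpotent matrices is triangular with respect to two coordinates. -/
theorem exists_triangular_pair (hn : 2 ≤ n) (G : LieSubalgebra ℂ (Module.End ℂ (Fin n → ℂ)))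
    (hG : ∀ φ ∈ G, IsNilpotent φ) :
    ∃ y₁ y₂ : Fin n → ℂ, LinearIndependent ℂ ![y₁, y₂] ∧ ∀ φ ∈ G, φ y₁ = 0 ∧
      ∃ c : ℂ, φ y₂ = c • y₁ := by
  have : Nontrivial (Fin n → ℂ) := by
    have : Nonempty (Fin n) := ⟨⟨0, by omega⟩⟩
    infer_instance
  have hnil : LieModule.IsNilpotent G (Fin n → ℂ) :=
    (LieModule.isNilpotent_iff_forall (R := ℂ)).mpr fun φ => hG φ φ.2
  have := LieModule.nontrivial_max_triv_of_isNilpotent ℂ G (Fin n → ℂ)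
  obtain ⟨y₁, hy₁⟩ := exists_ne
    (0 : LieModule.maxTrivSubmodule ℂ G (Fin n → ℂ))
  have hy₁0 : (y₁ : Fin n → ℂ) ≠ 0 := fun h => hy₁ (Subtype.ext h)
  have hy₁G : ∀ φ : G, ⁅φ, (y₁ : Fin n → ℂ)⁆ = 0 :=
    (LieModule.mem_maxTrivSubmodule ℂ G (Fin n → ℂ) _).mp y₁.2
  -- Engel's theorem applies a second time on the quotient by the line of y₁, which is non-zero
  -- because n ≥ 2; y₂ lifts an invariant vector of it.
  let K : LieSubmodule ℂ G (Fin n → ℂ) :=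
    { Submodule.span ℂ {(y₁ : Fin n → ℂ)} with
      lie_mem := by
        intro φ y hy
        obtain ⟨a, rfl⟩ := Submodule.mem_span_singleton.mp hy
        rw [lie_smul, hy₁G, smul_zero]
        exact Submodule.zero_mem _ }
  have hKmem : ∀ y, y ∈ K ↔ ∃ a : ℂ, a • (y₁ : Fin n → ℂ) = y := fun y =>
    Submodule.mem_span_singleton
  have : Nontrivial ((Fin n → ℂ) ⧸ K) := by
    refine Submodule.Quotient.nontrivial_iff.mpr fun h => ?_
    have h1 : Module.finrank ℂ (K : Submodule ℂ (Fin n → ℂ)) ≤ 1 :=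
      finrank_span_singleton hy₁0 |>.le
    rw [h, finrank_top, Module.finrank_fin_fun] at h1
    omega
  have hnilK : LieModule.IsNilpotent G ((Fin n → ℂ) ⧸ K) := by
    obtain ⟨k, hk⟩ := (LieModule.isNilpotent_iff ℂ G (Fin n → ℂ)).mp hnil
    exact (LieModule.isNilpotent_quotient_iff ℂ G (Fin n → ℂ) K).mpr ⟨k, hk ▸ bot_le⟩
  have := LieModule.nontrivial_max_triv_of_isNilpotent ℂ G ((Fin n → ℂ) ⧸ K)
  obtain ⟨z, hz⟩ := exists_ne (0 : LieModule.maxTrivSubmodule ℂ G ((Fin n → ℂ) ⧸ K))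
  obtain ⟨y₂, hy₂⟩ := Submodule.Quotient.mk_surjective (K : Submodule ℂ (Fin n → ℂ)) z.1
  have hy₂K : y₂ ∉ K := fun h => hz (Subtype.ext (by
    rw [← hy₂]
    exact (Submodule.Quotient.mk_eq_zero _).mpr h))
  refine ⟨y₁, y₂, ?_, fun φ hφ => ⟨hy₁G ⟨φ, hφ⟩, ?_⟩⟩
  · rw [LinearIndependent.pair_iff' hy₁0]
    exact fun a ha => hy₂K ((hKmem _).mpr ⟨a, ha⟩)
  · have h1 : ⁅(⟨φ, hφ⟩ : G), z.1⁆ = 0 :=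
      (LieModule.mem_maxTrivSubmodule ℂ G ((Fin n → ℂ) ⧸ K) _).mp z.2 _
    rw [← hy₂] at h1
    obtain ⟨a, ha⟩ := (hKmem _).mp
      ((Submodule.Quotient.mk_eq_zero (K : Submodule ℂ (Fin n → ℂ))).mp h1)
    exact ⟨a, ha.symm⟩

end Engel

/-! ### The trace identity and the extreme values of s. -/

/-- The trace identity for a logarithmic field that annihilates `Δ` and acts diagonally on a basis
of the Lie algebra of logarithmic vector fields of degree `0`. -/
theorem sum_eigenvalues_add_trace_eq_zero (hf : IsReducedEquation f)
    (hδ : IsLogBasis f Set.univ fun i => lin (δ i)) {ι : Type} [Fintype ι]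
    {b : ι → Matrix (Fin n) (Fin n) ℂ} (hb : LinearIndependent ℂ b)
    (hbs : Submodule.span ℂ (Set.range b) = tangentMatrices f) (hcard : Fintype.card ι = n)
    {A : Matrix (Fin n) (Fin n) ℂ} (hA : linDer A (discrPoly δ) = 0) {c : ι → ℂ}
    (hc : ∀ i, ⁅A, b i⁆ = c i • b i) : ∑ i, c i + A.trace = 0 := by
  let e : Fin n ≃ ι := Fintype.equivOfCardEq (by simp [hcard])
  have hbe : IsLogBasis f Set.univ fun i => lin ((b ∘ e) i) :=
    IsLogBasis.of_span_eq hf hδ ((linearIndependent_equiv e).mpr hb)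
      (by rw [e.surjective.range_comp, hbs])
  have hsum : ∀ i, ∃ r : Fin n → ℂ, ∑ k, r k • δ k = (b ∘ e) i := fun i => by
    rw [← Submodule.mem_span_range_iff_exists_fun, span_eq_of_isLogBasis hf hδ,
      ← span_eq_of_isLogBasis hf hbe]
    exact Submodule.subset_span ⟨i, rfl⟩
  choose R hR using hsum
  -- The discriminant of b is a constant multiple of Δ, so A kills it as well, and its eigenvalue
  -- there, ∑ cᵢ + tr A, must be zero.
  have h1 := linDer_discrPoly (δ := b ∘ e) (A := A) (C := diagonal (c ∘ e)) fun i => by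
    simp [diagonal_apply, hc]
  rw [discrPoly_eq_of_eq_sum (R := Matrix.of R) fun i => (hR i).symm, Derivation.map_smul, hA,
    smul_zero, ← discrPoly_eq_of_eq_sum (R := Matrix.of R) fun i => (hR i).symm,
    Matrix.trace_diagonal] at h1
  rw [← e.sum_comp]
  exact (smul_eq_zero.mp h1.symm).resolve_right (discrPoly_ne_zero hf hbe)

/-- In dimension at least `2`, if the Euler field spans a maximal torus, then it does not form a
basis of the logarithmic vector fields together with fields annihilating `Δ`. -/
theorem not_isLogBasis_one_nilpotent (hn : 2 ≤ n) (hf : IsReducedEquation f)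
    (hδ : IsLogBasis f Set.univ fun i => lin (δ i)) (hs : ∀ r ∈ diagonalRanks f, r ≤ 1) {m : ℕ}
    {ν : Fin m → Matrix (Fin n) (Fin n) ℂ} (hν : ∀ j, linDer (ν j) (discrPoly δ) = 0) :
    ¬ IsLogBasis f Set.univ
      (Sum.elim (fun _ : Unit => lin (1 : Matrix (Fin n) (Fin n) ℂ)) fun j => lin (ν j)) := by
  have : Nonempty (Fin n) := ⟨⟨0, by omega⟩⟩
  let _ : LieRing (Module.End ℂ (Fin n → ℂ)) := LieRing.ofAssociativeRing
  let _ : LieAlgebra ℂ (Module.End ℂ (Fin n → ℂ)) := LieAlgebra.ofAssociativeAlgebra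
  -- The annihilator of Δ. Since the torus is ℂχ alone, the semisimple part of each of its elements
  -- lies in the span of the empty family, so all of them are nilpotent.
  let G : LieSubalgebra ℂ (Module.End ℂ (Fin n → ℂ)) :=
    { carrier := {φ | linDer (LinearMap.toMatrix' φ) (discrPoly δ) = 0}
      add_mem' := fun {φ ψ} (hφ : linDer _ _ = 0) (hψ : linDer _ _ = 0) => by
        change linDer _ _ = 0
        rw [map_add, linDer_add, Derivation.add_apply, hφ, hψ, add_zero]
      zero_mem' := by
        change linDer _ _ = 0
        rw [map_zero, linDer_zero]
        rfl
      smul_mem' := fun a φ (hφ : linDer _ _ = 0) => by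
        change linDer _ _ = 0
        rw [map_smul, linDer_smul, Derivation.smul_apply, hφ, smul_zero]
      lie_mem' := fun {φ ψ} (hφ : linDer _ _ = 0) (hψ : linDer _ _ = 0) => by
        have : LinearMap.toMatrix' ⁅φ, ψ⁆ = ⁅LinearMap.toMatrix' φ, LinearMap.toMatrix' ψ⁆ := by
          rw [Ring.lie_def, Ring.lie_def, map_sub, LinearMap.toMatrix'_mul,
            LinearMap.toMatrix'_mul]
        change linDer (LinearMap.toMatrix' ⁅φ, ψ⁆) (discrPoly δ) = 0
        rw [this, linDer_lie, Derivation.commutator_apply, hφ, hψ, map_zero, map_zero,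
          sub_zero] }
  have : Subsingleton (Fin (0 + 1)) := inferInstanceAs (Subsingleton (Fin 1))
  have hG : ∀ φ ∈ G, IsNilpotent φ := by
    intro φ hφ
    have hφ' : linDer (LinearMap.toMatrix' φ) (discrPoly δ) = 0 := hφ
    obtain ⟨S, N, h⟩ := exists_isJordanDecomposition (LinearMap.toMatrix' φ)
    have hS := (h.mem_span_torus (s := 0) (P := 1) (w := Fin.elim0) (by omega) hf hδ hs (by simp)
      (LinearIndependent.of_subsingleton 0 (by simp))
      (fun i => i.elim0) ((mem_tangentMatrices_iff hf hδ _).mpr ⟨0, by rw [hφ', zero_smul]⟩)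
      (fun i => i.elim0)).2 hφ'
    have hS0 : S = 0 := by simpa [Set.range_eq_empty] using hS
    have hA := h.eq_add
    rw [hS0, zero_add] at hA
    have : φ = Matrix.toLinAlgEquiv' N := by
      rw [← hA]
      exact (Matrix.toLin'_toMatrix' φ).symm
    rw [this]
    exact h.nilpotent.map _
  obtain ⟨y₁, y₂, hy, hyG⟩ := exists_triangular_pair hn G hG
  have hνG : ∀ j, Matrix.toLin' (ν j) ∈ G := fun j => by
    change linDer (LinearMap.toMatrix' (Matrix.toLin' (ν j))) (discrPoly δ) = 0
    rw [LinearMap.toMatrix'_toLin', hν]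
  exact not_isLogBasis_of_triangular hf hy (fun j => (hyG _ (hνG j)).1) fun j =>
    (hyG _ (hνG j)).2

/-- If all logarithmic vector fields of degree `0` are diagonal, then the divisor is a normal
crossing divisor. -/
theorem exists_discr_eq_prod (hn : 1 ≤ n) (hf : IsReducedEquation f)
    (hδ : IsLogBasis f Set.univ fun i => lin (δ i)) {P : Matrix (Fin n) (Fin n) ℂ}
    (hP : IsUnit P.det) (hd : ∀ i, ∃ d, conjDiag P d = δ i) :
    ∃ Q : Matrix (Fin n) (Fin n) ℂ, IsUnit Q.det ∧ (∀ x, discr δ x = ∏ k, lin Q x k) ∧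
      {x | f x = 0} = {x | ∃ k, lin Q x k = 0} := by
  choose d hd using hd
  let c : ℂ := (Matrix.of d).det * P⁻¹.det
  have hdisc : ∀ x, discr δ x = c * ∏ k, lin P x k := by
    intro x
    have : (Matrix.of fun i => lin (δ i) x) = Matrix.of d * diagonal (lin P x) * P⁻¹ := by
      refine Matrix.ext fun i j => ?_
      simp only [Matrix.of_apply, ← hd, conjDiag_apply, lin, ← Matrix.vecMul_vecMul]
      rw [Matrix.mul_apply, Matrix.vecMul, dotProduct]
      refine Finset.sum_congr rfl fun k _ => ?_
      rw [Matrix.vecMul_diagonal, Matrix.mul_diagonal, Matrix.of_apply, mul_comm (d i k)]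
    rw [discr_eq_det, this, Matrix.det_mul, Matrix.det_mul, Matrix.det_diagonal]
    ring
  have hc : c ≠ 0 := by
    obtain ⟨x, hx⟩ := hf.ne_zero
    have := discr_ne_zero_of_ne_zero hf.holomorphic hδ hx
    rw [hdisc] at this
    exact left_ne_zero_of_mul this
  -- Rescaling the first coordinate absorbs the constant c.
  let u : Fin n → ℂ := fun k => if k = ⟨0, hn⟩ then c else 1
  have hu : ∏ k, u k = c := by simp [u]
  have hlin : ∀ x k, lin (P * diagonal u) x k = lin P x k * u k := by
    intro x k
    simp only [lin, ← Matrix.vecMul_vecMul, Matrix.vecMul_diagonal]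
  have hprod : ∀ x, discr δ x = ∏ k, lin (P * diagonal u) x k := by
    intro x
    simp only [hlin, Finset.prod_mul_distrib, hu]
    rw [hdisc, mul_comm]
  refine ⟨P * diagonal u, ?_, hprod, ?_⟩
  · rw [Matrix.det_mul, Matrix.det_diagonal, hu]
    exact hP.mul hc.isUnit
  · ext x
    change f x = 0 ↔ _
    rw [eq_zero_iff_discr_eq_zero hf hδ, hprod, Finset.prod_eq_zero_iff]
    simp

end LFD

/-! ### Assembly of the basis. -/

theorem theorem51 {n : ℕ} (hn : 1 ≤ n) (f : (Fin n → ℂ) → ℂ) (hf : LFD.IsLinearFree f)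
    (δ : Fin n → Matrix (Fin n) (Fin n) ℂ)
    (hδ : LFD.IsLogBasis f Set.univ (fun i => LFD.lin (δ i))) :
    ∃ s m : ℕ, 1 + s + m = n ∧ IsGreatest (LFD.diagonalRanks f) (s + 1) ∧
      (∃ (χ : Matrix (Fin n) (Fin n) ℂ) (σ : Fin s → Matrix (Fin n) (Fin n) ℂ)
          (ν : Fin m → Matrix (Fin n) (Fin n) ℂ),
        (∀ x, LFD.lin χ x = x) ∧
        LFD.IsLogBasis f Set.univ
          (Sum.elim (fun _ : Unit => LFD.lin χ)
            (Sum.elim (fun i => LFD.lin (σ i)) (fun j => LFD.lin (ν j)))) ∧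
        ((∀ i, ⁅χ, σ i⁆ = 0) ∧ (∀ j, ⁅χ, ν j⁆ = 0)) ∧
        ((∃ P : Matrix (Fin n) (Fin n) ℂ, IsUnit P.det ∧ ∃ w : Fin s → Fin n → ℚ,
            ∀ i, σ i = P * Matrix.diagonal (fun k => (w i k : ℂ)) * P⁻¹) ∧
          ∀ i x, LFD.act (LFD.lin (σ i)) (LFD.discr δ) x = 0) ∧
        ((∀ j, IsNilpotent (ν j)) ∧ ∀ j x, LFD.act (LFD.lin (ν j)) (LFD.discr δ) x = 0) ∧
        (∃ q : Fin s → Fin m → ℚ, (∀ i j, ⁅σ i, ν j⁆ = (q i j : ℂ) • ν j) ∧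
          ∀ i, (∑ j, (q i j : ℂ)) + (σ i).trace = 0) ∧
        (∀ A S N : Matrix (Fin n) (Fin n) ℂ, LFD.IsLogarithmic f Set.univ (LFD.lin A) →
          (∀ i, ⁅σ i, A⁆ = 0) → LFD.IsJordanDecomposition A S N →
            S ∈ Submodule.span ℂ (insert χ (Set.range σ)) ∧
            ((∀ x, LFD.act (LFD.lin A) (LFD.discr δ) x = 0) →
              S ∈ Submodule.span ℂ (Set.range σ)))) ∧
      (2 ≤ n → 1 ≤ s) ∧
      (s = n - 1 → ∃ P : Matrix (Fin n) (Fin n) ℂ, IsUnit P.det ∧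
        (∀ x, LFD.discr δ x = ∏ k, LFD.lin P x k) ∧
        {x | f x = 0} = {x | ∃ k, LFD.lin P x k = 0}) := by

  obtain ⟨hf, -, -⟩ := hf
  obtain ⟨s, hgreat, P, hP, w, hw, hker⟩ := LFD.exists_rational_torus hn hf hδ
  have hs : ∀ r ∈ LFD.diagonalRanks f, r ≤ s + 1 := fun r hr => hgreat.2 hr
  let σ : Fin s → Matrix (Fin n) (Fin n) ℂ := fun i => LFD.conjDiag P fun k => (w i k : ℂ)
  have hσL : ∀ i, σ i ∈ LFD.tangentMatrices f := fun i =>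
    (LFD.mem_tangentMatrices_iff hf hδ _).mpr ⟨0, by rw [hker, zero_smul]⟩
  have hv : LinearIndependent ℂ (Fin.cons 1 σ : Fin (s + 1) → Matrix (Fin n) (Fin n) ℂ) := by
    have h := hw.map' (LFD.conjDiag P) (LinearMap.ker_eq_bot.mpr (LFD.conjDiag_injective hP))
    have hcons : (Fin.cons 1 σ : Fin (s + 1) → Matrix (Fin n) (Fin n) ℂ) =
        LFD.conjDiag P ∘ Fin.cons 1 fun i k => (w i k : ℂ) := by
      funext i
      exact Fin.cases (LFD.conjDiag_one hP).symm (fun i => rfl) i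
    rw [hcons]
    exact h
  obtain ⟨m, ν, hν, hlin, hspan⟩ := LFD.exists_extension_of_span hv
    {A | A ∈ LFD.tangentMatrices f ∧ IsNilpotent A ∧
      ∃ q : Fin s → ℚ, ∀ i, ⁅σ i, A⁆ = (q i : ℂ) • A}
  choose hνL hνn q hq using hν
  rw [Fin.range_cons] at hspan
  -- Pure reindexing: χ moves from the head of the torus family to a summand of its own.
  let e : Unit ⊕ (Fin s ⊕ Fin m) ≃ Fin (s + 1) ⊕ Fin m :=
    (Equiv.sumAssoc _ _ _).symm.trans (Equiv.sumCongr ((Equiv.sumComm _ _).trans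
      ((Equiv.optionEquivSumPUnit (Fin s)).symm.trans (finSuccEquiv s).symm)) (Equiv.refl _))
  let b : Unit ⊕ (Fin s ⊕ Fin m) → Matrix (Fin n) (Fin n) ℂ :=
    Sum.elim (fun _ => 1) (Sum.elim σ ν)
  have hbe : b = Sum.elim (Fin.cons 1 σ : Fin (s + 1) → Matrix (Fin n) (Fin n) ℂ) ν ∘ e := by
    funext x
    rcases x with _ | i | j <;> simp [b, e]
  have hb : LinearIndependent ℂ b := by
    rw [hbe]
    exact (linearIndependent_equiv e).mpr hlin
  have hbs : Submodule.span ℂ (Set.range b) = LFD.tangentMatrices f := by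
    apply le_antisymm
    · rw [Submodule.span_le]
      rintro _ ⟨_ | i | j, rfl⟩
      · exact LFD.one_mem_tangentMatrices hf hδ
      · exact hσL i
      · exact hνL j
    · rw [hbe, e.surjective.range_comp, hspan]
      exact LFD.tangentMatrices_le_span hn hf hδ hs hP hw hker
  have hcard : 1 + s + m = n := by
    have h1 := finrank_span_eq_card hb
    have h2 := finrank_span_eq_card (LFD.linearIndependent_of_isLogBasis hδ)
    rw [LFD.span_eq_of_isLogBasis hf hδ, ← hbs, h1] at h2
    simpa [add_assoc] using h2
  have hνk : ∀ j, LFD.linDer (ν j) (LFD.discrPoly δ) = 0 := fun j => by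
    obtain ⟨c, hc⟩ := (LFD.mem_tangentMatrices_iff hf hδ _).mp (hνL j)
    exact LFD.linDer_eq_zero_of_isNilpotent (hνn j) hc
  refine ⟨s, m, hcard, hgreat, ⟨1, σ, ν, LFD.lin_one, ?_, ⟨fun i => ?_, fun j => ?_⟩,
    ⟨⟨P, hP, w, fun i => rfl⟩, fun i => ?_⟩, ⟨hνn, fun j => ?_⟩,
    ⟨fun i j => q j i, fun i j => hq j i, fun i => ?_⟩, fun A S N hA hc h => ?_⟩,
    fun h2 => ?_, fun hsn => ?_⟩
  · convert LFD.IsLogBasis.of_span_eq hf hδ hb hbs using 1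
    funext x
    rcases x with _ | i | j <;> rfl
  · simp [Ring.lie_def]
  · simp [Ring.lie_def]
  · exact (LFD.act_discr_eq_zero_iff δ _).mpr (hker i)
  · exact (LFD.act_discr_eq_zero_iff δ _).mpr (hνk j)
  -- χ and the σ's commute with σᵢ and contribute eigenvalue 0, so only the roots of the ν's remain
  -- in the sum.
  · have := LFD.sum_eigenvalues_add_trace_eq_zero hf hδ hb hbs (by simpa [add_assoc] using hcard)
      (hker i) (c := Sum.elim (fun _ => 0) (Sum.elim (fun _ => 0) fun j => (q j i : ℂ))) (by
        rintro (_ | i' | j)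
        · simp [b, Ring.lie_def]
        · simpa [b] using LFD.lie_eq_zero_of_commute (LFD.commute_conjDiag hP _ _)
        · exact hq j i)
    simpa using this
  · have := h.mem_span_torus hn hf hδ hs hP hw hker ((LFD.isLogarithmic_lin_iff hf A).mp hA) hc
    exact ⟨this.1, fun hA0 => this.2 ((LFD.act_discr_eq_zero_iff δ A).mp hA0)⟩
  · by_contra hs0
    obtain rfl : s = 0 := by omega
    refine LFD.not_isLogBasis_one_nilpotent h2 hf hδ hs hνk ?_
    have hinj : Function.Injective (Sum.map id Sum.inr : Unit ⊕ Fin m → Unit ⊕ (Fin 0 ⊕ Fin m)) :=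
      Function.injective_id.sumMap Sum.inr_injective
    have hsurj : Function.Surjective
        (Sum.map id Sum.inr : Unit ⊕ Fin m → Unit ⊕ (Fin 0 ⊕ Fin m)) := by
      rintro (_ | i | j)
      · exact ⟨Sum.inl (), rfl⟩
      · exact i.elim0
      · exact ⟨Sum.inr j, rfl⟩
    convert LFD.IsLogBasis.of_span_eq hf hδ (hb.comp _ hinj)
      (by rw [hsurj.range_comp, hbs]) using 1
    funext x
    rcases x with _ | j <;> rfl
  · obtain rfl : m = 0 := by omega
    refine LFD.exists_discr_eq_prod hn hf hδ hP fun i => ?_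
    have hle : LFD.tangentMatrices f ≤ LinearMap.range (LFD.conjDiag P) := by
      rw [← hbs, Submodule.span_le]
      rintro _ ⟨_ | i | j, rfl⟩
      · exact ⟨1, LFD.conjDiag_one hP⟩
      · exact ⟨_, rfl⟩
      · exact j.elim0
    exact hle ((LFD.isLogarithmic_lin_iff hf _).mp (hδ.1 i))
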